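/- Let $n\ge 1$ and let $\mu\subseteq\lambda$ be partitions, drawn as Young diagrams in English notation. An \emph{$n$-ribbon} is a connected skew shape with $n$ boxes that contains no $2\times 2$ square; its \emph{spin} is the number of rows it occupies minus one. A tiling of a skew shape by $n$-ribbons is a \emph{horizontal ribbon strip} if the top-right-most box of each ribbon touches the northern boundary of the shape (no box of the shape lies directly above it), and a \emph{vertical ribbon strip} if the bottom-left-most box of each ribbon touches the western boundary of the shape (no box of the shape lies directly to its left). Let $A=\{1<\dots<r\}$ and $A'=\{1'<\dots<s'\}$, and let $\prec$ be a total order on the disjoint union $A\sqcup A'$ extending the orders of $A$ and of $A'$. A \emph{super $n$-ribbon tableau} of shape $\lambda/\mu$ (with respect to $\prec$) is a tiling $T$ of $\lambda/\mu$ by $n$-ribbons, each labelled by an element of $A\sqcup A'$, such that for each $a\in A$ the ribbons labelled $a$ form a horizontal ribbon strip, for each $b\in A'$ the ribbons labelled $b$ form a vertical ribbon strip, and for each $k\in A\sqcup A'$ the ribbons with label $\preceq k$ together cover a skew shape $\nu/\mu$ for some partition $\nu\supseteq\mu$. Let $\mathrm{spin}(T)$ be the sum of the spins of the ribbons of $T$,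 and for $a\in A$, $b\in A'$ let $\mathrm{wt}(T)_a$ and $\mathrm{wt}'(T)_b$ be the numbers of ribbons labelled $a$ and $b$. The \emph{super LLT polynomial} is $$\mathcal G^{(n)}_{\lambda/\mu}(X/Y;q)=\sum_{T} q^{\mathrm{spin}(T)}\prod_{a\in A}x_a^{\mathrm{wt}(T)_a}\prod_{b\in A'}(-y_b)^{\mathrm{wt}'(T)_b}\in\mathbb Z[q][x_1,\dots,x_r,y_{1'},\dots,y_{s'}],$$ the sum being over all super $n$-ribbon tableaux $T$ of shape $\lambda/\mu$ with respect to $\prec$. Then, for every such $\prec$, the polynomial $\mathcal G^{(n)}_{\lambda/\mu}(X/Y;q)$ is invariant under all permutations of the variables $x_1,\dots,x_r$ and under all permutations of the variables $y_{1'},\dots,y_{s'}$. Moreover it does not depend on $\prec$: any two total orders on $A\sqcup A'$ extending the orders of $A$ and $A'$ give the same polynomial. -/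

import Mathlib

open Finset

namespace SuperLLT

/-- The boxes of the skew diagram `lam / mu`. A box is `(row, column)`, rows numbered downwards
and columns to the right, starting from `0`. -/
def skewCells (lam mu : YoungDiagram) : Finset (ℕ × ℕ) := lam.cells \ mu.cells

/-- A finite set of boxes is a skew shape if it is the diagram of some `lam / mu`
with `mu ⊆ lam`. -/
def IsSkewShape (R : Finset (ℕ × ℕ)) : Prop :=
  ∃ lam mu : YoungDiagram, mu ≤ lam ∧ R = skewCells lam mu

/-- An `n`-ribbon: a connected skew shape with `n` boxes and no `2 × 2` square. In the Hasse
diagram of `ℕ × ℕ` two boxes are adjacent exactly when they share an edge. -/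
structure IsRibbon (n : ℕ) (R : Finset (ℕ × ℕ)) : Prop where
  isSkewShape : IsSkewShape R
  card_eq : R.card = n
  connected : ((SimpleGraph.hasse (ℕ × ℕ)).induce (R : Set (ℕ × ℕ))).Connected
  no_square : ∀ i j : ℕ,
    ¬ ((i, j) ∈ R ∧ (i, j + 1) ∈ R ∧ (i + 1, j) ∈ R ∧ (i + 1, j + 1) ∈ R)

/-- The spin of a ribbon: its height (number of rows that it meets) minus one. -/
def spin (R : Finset (ℕ × ℕ)) : ℕ := (R.image Prod.fst).card - 1

/-- `c` is the top-right-most box of `R`. -/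
def IsTopRight (R : Finset (ℕ × ℕ)) (c : ℕ × ℕ) : Prop :=
  c ∈ R ∧ ∀ d ∈ R, c.1 ≤ d.1 ∧ d.2 ≤ c.2

/-- `c` is the bottom-left-most box of `R`. -/
def IsBottomLeft (R : Finset (ℕ × ℕ)) (c : ℕ × ℕ) : Prop :=
  c ∈ R ∧ ∀ d ∈ R, d.1 ≤ c.1 ∧ c.2 ≤ d.2

/-- The box `c` touches the northern boundary of the shape `S`: no box of `S` lies directly
above it. -/
def TouchesNorth (S : Finset (ℕ × ℕ)) (c : ℕ × ℕ) : Prop :=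
  ∀ i : ℕ, i + 1 = c.1 → (i, c.2) ∉ S

/-- The box `c` touches the western boundary of the shape `S`: no box of `S` lies directly
to the left of it. -/
def TouchesWest (S : Finset (ℕ × ℕ)) (c : ℕ × ℕ) : Prop :=
  ∀ j : ℕ, j + 1 = c.2 → (c.1, j) ∉ S

/-- The ribbons in `P` (tiles of the shape that they cover) form a horizontal ribbon strip. -/
def IsHorizontalStrip (P : Finset (Finset (ℕ × ℕ))) : Prop :=
  ∀ R ∈ P, ∃ c, IsTopRight R c ∧ TouchesNorth (P.sup id) c

/-- The ribbons in `P` (tiles of the shape that they cover) form a vertical ribbon strip;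
this is the transpose of `IsHorizontalStrip`. -/
def IsVerticalStrip (P : Finset (Finset (ℕ × ℕ))) : Prop :=
  ∀ R ∈ P, ∃ c, IsBottomLeft R c ∧ TouchesWest (P.sup id) c

/-- A total order on the disjoint union of the alphabets `A = {1, …, r}` and
`A' = {1', …, s'}` that extends the given orders of `A` and of `A'`. -/
structure RespectsAlphabets {r s : ℕ} (o : LinearOrder (Fin r ⊕ Fin s)) : Prop where
  inl_le : ∀ i j : Fin r, i ≤ j → o.le (Sum.inl i) (Sum.inl j)
  inr_le : ∀ i j : Fin s, i ≤ j → o.le (Sum.inr i) (Sum.inr j)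

/-- A super `n`-ribbon tableau of shape `lam / mu` for the total order `o` on `A ⊔ A'`. -/
@[ext]
structure SuperRibbonTableau (n : ℕ) (lam mu : YoungDiagram) {r s : ℕ}
    (o : LinearOrder (Fin r ⊕ Fin s)) where
  /-- the tiling -/
  tiling : Finpartition (skewCells lam mu)
  /-- the labels of the tiles -/
  label : {R // R ∈ tiling.parts} → Fin r ⊕ Fin s
  ribbon : ∀ R ∈ tiling.parts, IsRibbon n R
  horizontal : ∀ a : Fin r,
    IsHorizontalStrip ((univ.filter fun R => label R = Sum.inl a).image Subtype.val)
  vertical : ∀ b : Fin s,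
    IsVerticalStrip ((univ.filter fun R => label R = Sum.inr b).image Subtype.val)
  /-- Removing the ribbons with label larger than `k` leaves a skew shape `nu / mu`. -/
  initial : ∀ k : Fin r ⊕ Fin s, ∃ nu : YoungDiagram, mu ≤ nu ∧
    ∀ c : ℕ × ℕ, c ∈ skewCells nu mu ↔ ∃ R, o.le (label R) k ∧ c ∈ R.1

/-- The tiling and the labels determine the tableau. -/
theorem SuperRibbonTableau.toSigma_injective (n : ℕ) (lam mu : YoungDiagram) {r s : ℕ}
    (o : LinearOrder (Fin r ⊕ Fin s)) :
    Function.Injective (fun T : SuperRibbonTableau n lam mu o =>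
      (⟨T.tiling, T.label⟩ :
        Σ P : Finpartition (skewCells lam mu), ({R // R ∈ P.parts} → Fin r ⊕ Fin s))) := by
  rintro ⟨P, f, _, _, _, _⟩ ⟨Q, g, _, _, _, _⟩ h
  simp only [Sigma.mk.injEq] at h
  obtain ⟨rfl, h⟩ := h
  cases h
  rfl

noncomputable instance (n : ℕ) (lam mu : YoungDiagram) {r s : ℕ}
    (o : LinearOrder (Fin r ⊕ Fin s)) : Fintype (SuperRibbonTableau n lam mu o) :=
  Fintype.ofInjective _ (SuperRibbonTableau.toSigma_injective n lam mu o)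

namespace SuperRibbonTableau

variable {n : ℕ} {lam mu : YoungDiagram} {r s : ℕ} {o : LinearOrder (Fin r ⊕ Fin s)}

/-- The spin of a tableau is the sum of the spins of its ribbons. -/
def spin (T : SuperRibbonTableau n lam mu o) : ℕ := ∑ R ∈ T.tiling.parts, SuperLLT.spin R

/-- The number of ribbons with label `k`. For `k` in `A` this is the entry of the weight `wt(T)`,
for `k` in `A'` that of `wt'(T)`. -/
def wt (T : SuperRibbonTableau n lam mu o) (k : Fin r ⊕ Fin s) : ℕ :=
  (univ.filter fun R => T.label R = k).card

end SuperRibbonTableau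

/-- The super LLT polynomial of shape `lam / mu`, as a polynomial over `ℤ[q]` in the variables
`x_a` (`Sum.inl a`) and `y_b` (`Sum.inr b`). -/
noncomputable def superLLT (n : ℕ) (lam mu : YoungDiagram) {r s : ℕ}
    (o : LinearOrder (Fin r ⊕ Fin s)) : MvPolynomial (Fin r ⊕ Fin s) (Polynomial ℤ) :=
  ∑ T : SuperRibbonTableau n lam mu o,
    MvPolynomial.C (Polynomial.X ^ T.spin) *
      (∏ a : Fin r, MvPolynomial.X (Sum.inl a) ^ T.wt (Sum.inl a)) *
      ∏ b : Fin s, (-MvPolynomial.X (Sum.inr b)) ^ T.wt (Sum.inr b)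

end SuperLLT


/-!
Reading a ribbon tableau from the smallest label to the largest builds `lam` from `mu` by adding
one ribbon strip per label. On the bead configuration of a partition, adding an `n`-ribbon with
smallest content `i` moves a bead from `i` to `i + n`, and its spin is the number of beads jumped
over. Hence the polynomial is a matrix coefficient of a product, over the labels in increasing
order, of operators on functions of bead configurations: if `u i` adds a ribbon with smallest
content `i`, then the operator of a horizontal strip of weight `x` is the product of the
`1 + x u i` taken in decreasing order of `i`, and that of a vertical strip of weight `y` is the
same product taken in increasing order.

Following Fomin and Greene, the relations `u i ^ 2 = 0`, `u i * u j * u i = 0` and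
`[u m, [u i, u j]] = 0` for `i < m < j` imply that the operators of horizontal strips commute.
Since `u i ^ 2 = 0`, the operator of a vertical strip of weight `y` is the inverse of that of a
horizontal strip of weight `-y`. So all the operators commute, and neither the order of the
labels nor a permutation of the weights changes the product.
-/

namespace SuperLLT

/-! ### Ordered products of ribbon operators -/

section RibbonRelations

/-- The relations between the ribbon operators that make the operators of strips commute. -/
structure RibbonRelations {ι A : Type*} [LT ι] [Ring A] (u : ι → A) : Prop where
  mul_self : ∀ i, u i * u i = 0
  mul_mul_self : ∀ i j, u i * u j * u i = 0
  commute_lie : ∀ ⦃i m j⦄, i < m → m < j → Commute (u m) ⁅u i, u j⁆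

variable {ι S A : Type*} [CommRing S] [Ring A] [Algebra S A] {u : ι → A}

theorem one_add_smul_commute (u : A) (x y : S) : Commute (1 + x • u) (1 + y • u) :=
  ((Commute.one_left _).add_left
    ((Commute.one_right _).add_right (((Commute.refl u).smul_right y).smul_left x)))

theorem one_add_smul_mul_one_add_neg_smul {u : A} (hu : u * u = 0) (x : S) :
    (1 + x • u) * (1 + (-x) • u) = 1 := by
  simp [mul_add, add_mul, hu]

/-- The product of the factors `1 + x u i` along a list. -/
def orderedProd (u : ι → A) (x : S) (l : List ι) : A := (l.map fun i => 1 + x • u i).prod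

@[simp]
theorem orderedProd_nil (u : ι → A) (x : S) : orderedProd u x [] = 1 := rfl

@[simp]
theorem orderedProd_cons (u : ι → A) (x : S) (i : ι) (l : List ι) :
    orderedProd u x (i :: l) = (1 + x • u i) * orderedProd u x l := List.prod_cons

theorem orderedProd_concat (u : ι → A) (x : S) (l : List ι) (i : ι) :
    orderedProd u x (l ++ [i]) = orderedProd u x l * (1 + x • u i) := by
  simp [orderedProd]

theorem orderedProd_mul_orderedProd_neg_reverse (hu : ∀ i, u i * u i = 0) (x : S) (l : List ι) :
    orderedProd u x l * orderedProd u (-x) l.reverse = 1 := by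
  induction l with
  | nil => simp
  | cons i l ih =>
    rw [List.reverse_cons, orderedProd_cons, orderedProd_concat, mul_assoc, ← mul_assoc _ _ (_ + _),
      ih, one_mul, one_add_smul_mul_one_add_neg_smul (hu i)]

namespace RibbonRelations

section LT

variable [LT ι]

theorem one_add_smul_mul_one_add_smul (hu : RibbonRelations u) (x y : S) (i j : ι) :
    (1 + x • u j) * (1 + y • u i) =
      (1 + y • u i) * (1 + (x * y) • ⁅u j, u i⁆) * (1 + x • u j) := by
  have hj (a : A) : a * u j * u j = 0 := by rw [mul_assoc, hu.mul_self, mul_zero]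
  simp only [Ring.lie_def, mul_add, add_mul, mul_sub, sub_mul, smul_mul_assoc, mul_smul_comm,
    ← mul_assoc, one_mul, mul_one, smul_sub, hu.mul_self, hu.mul_mul_self, hj, smul_zero, zero_mul]
  module

end LT

variable [Preorder ι]

/-- Moving a factor to the left past a decreasing product produces a correction that is symmetric
in `x` and `y`. -/
theorem orderedProd_mul_one_add_smul (hu : RibbonRelations u) (x y : S) {i : ι} {l : List ι}
    (hl : (i :: l).SortedGT) :
    orderedProd u x l * (1 + y • u i) =
      (1 + y • u i) * orderedProd (fun j => ⁅u j, u i⁆) (x * y) l * orderedProd u x l := by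
  induction l with
  | nil => simp
  | cons j l ih =>
    rw [List.sortedGT_iff_pairwise, List.pairwise_cons, List.pairwise_cons] at hl
    obtain ⟨hi, hj, hl⟩ := hl
    have hcomm : Commute (1 + x • u j) (orderedProd (fun k => ⁅u k, u i⁆) (x * y) l) := by
      refine Commute.list_prod_right _ _ fun c hc => ?_
      obtain ⟨k, hk, rfl⟩ := List.mem_map.1 hc
      have hk' := hu.commute_lie (hj k hk) (hi j List.mem_cons_self)
      exact (Commute.one_left _).add_left
        ((Commute.one_right _).add_right ((hk'.smul_right _).smul_left _))
    have ih := ih (List.sortedGT_iff_pairwise.2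
      (List.pairwise_cons.2 ⟨fun k hk => hi k (List.mem_cons_of_mem j hk), hl⟩))
    calc orderedProd u x (j :: l) * (1 + y • u i)
        = (1 + x • u j) * (1 + y • u i) * orderedProd (fun k => ⁅u k, u i⁆) (x * y) l *
            orderedProd u x l := by
          rw [orderedProd_cons, mul_assoc, ih]; simp only [mul_assoc]
      _ = (1 + y • u i) * (1 + (x * y) • ⁅u j, u i⁆) *
            ((1 + x • u j) * orderedProd (fun k => ⁅u k, u i⁆) (x * y) l) *
            orderedProd u x l := by
          rw [hu.one_add_smul_mul_one_add_smul]; simp only [mul_assoc]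
      _ = _ := by
          rw [hcomm.eq, orderedProd_cons, orderedProd_cons]; simp only [mul_assoc]

theorem orderedProd_commute (hu : RibbonRelations u) (x y : S) {l : List ι} (hl : l.SortedGT) :
    Commute (orderedProd u x l) (orderedProd u y l) := by
  induction l with
  | nil => exact Commute.one_left _
  | cons i l ih =>
    have ih := ih (List.sortedGT_iff_pairwise.2 (List.sortedGT_iff_pairwise.1 hl).of_cons)
    have swap (x y : S) : orderedProd u x (i :: l) * orderedProd u y (i :: l) =
        (1 + x • u i) * (1 + y • u i) * orderedProd (fun j => ⁅u j, u i⁆) (x * y) l *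
          (orderedProd u x l * orderedProd u y l) := by
      rw [orderedProd_cons, orderedProd_cons, mul_assoc, ← mul_assoc (orderedProd u x l),
        hu.orderedProd_mul_one_add_smul x y hl]
      simp only [mul_assoc]
    rw [commute_iff_eq, swap x y, swap y x, mul_comm y x, ih.eq,
      (one_add_smul_commute (u i) x y).eq]

end RibbonRelations

/-- The operator of a strip with weight `x`, for a decreasing list `l` of positions: horizontal
strips (`hor = true`) use the order of `l`, vertical ones the opposite order. -/
def stripProd (u : ι → A) (l : List ι) (hor : Bool) (x : S) : A :=
  orderedProd u x (if hor then l else l.reverse)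

theorem RibbonRelations.stripProd_commute [Preorder ι] (hu : RibbonRelations u) {l : List ι}
    (hl : l.SortedGT) (hor hor' : Bool) (x x' : S) :
    Commute (stripProd u l hor x) (stripProd u l hor' x') := by
  let U (x : S) : Aˣ :=
    { val := orderedProd u x l
      inv := orderedProd u (-x) l.reverse
      val_inv := orderedProd_mul_orderedProd_neg_reverse hu.mul_self x l
      inv_val := by
        simpa using orderedProd_mul_orderedProd_neg_reverse hu.mul_self (-x) l.reverse }
  have hU (x y : S) : Commute (U x : A) (U y) := hu.orderedProd_commute x y hl
  have htrue (x : S) : stripProd u l true x = U x := rfl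
  have hfalse (x : S) : stripProd u l false x = ↑(U (-x))⁻¹ := by
    simp [stripProd, U, Units.inv_mk]
  cases hor <;> cases hor' <;> simp only [htrue, hfalse]
  · exact (hU _ _).units_inv_left.units_inv_right
  · exact (hU _ _).units_inv_left
  · exact (hU _ _).units_inv_right
  · exact hU _ _

end RibbonRelations

/-! ### The ribbon operators on bead configurations -/

section Beads

open Classical in
/-- The number of elements of `C` strictly between `i` and `i + n`. -/
noncomputable def beadsBetween (n : ℕ) (i : ℤ) (C : Set ℤ) : ℕ :=
  ((Ioo i (i + n)).filter (· ∈ C)).card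

/-- The configuration `C` after its bead at `i + n` is moved to `i`. -/
def moveDown (n : ℕ) (i : ℤ) (C : Set ℤ) : Set ℤ := {t | t = i ∨ (t ∈ C ∧ t ≠ i + n)}

/-- The bead at `i + n` of the configuration `C` can be moved to `i`. -/
def CanMoveDown (n : ℕ) (i : ℤ) (C : Set ℤ) : Prop := i ∉ C ∧ i + n ∈ C

variable {S : Type*} [CommRing S]

open Classical in
/-- The operator that adds an `n`-ribbon whose smallest content is `i`. A function on bead
configurations stands for a formal sum of partitions, so the value at `C` of the new function is
read off from the configuration in which the ribbon is removed. -/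
noncomputable def addRibbon (n : ℕ) (q : S) (i : ℤ) : Module.End S (Set ℤ → S) where
  toFun v C := if CanMoveDown n i C then q ^ beadsBetween n i C * v (moveDown n i C) else 0
  map_add' v w := by
    ext C; simp only [Pi.add_apply]; split_ifs <;> ring
  map_smul' c v := by
    ext C; simp only [Pi.smul_apply, smul_eq_mul, RingHom.id_apply]; split_ifs <;> ring

open Classical in
theorem addRibbon_apply (n : ℕ) (q : S) (i : ℤ) (v : Set ℤ → S) (C : Set ℤ) :
    addRibbon n q i v C =
      if CanMoveDown n i C then q ^ beadsBetween n i C * v (moveDown n i C) else 0 := rfl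

variable {n : ℕ} {q : S} {i j : ℤ} {C : Set ℤ}

@[simp]
theorem mem_moveDown {t : ℤ} : t ∈ moveDown n i C ↔ t = i ∨ (t ∈ C ∧ t ≠ i + n) := Iff.rfl

theorem moveDown_comm (h₁ : j ≠ i + n) (h₂ : i ≠ j + n) (C : Set ℤ) :
    moveDown n i (moveDown n j C) = moveDown n j (moveDown n i C) := by
  ext t
  simp only [mem_moveDown]
  grind

theorem not_canMoveDown_moveDown_self : ¬ CanMoveDown n i (moveDown n i C) := by
  simp [CanMoveDown]

theorem not_canMoveDown_moveDown_moveDown (h : CanMoveDown n i C) :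
    ¬ CanMoveDown n i (moveDown n j (moveDown n i C)) := by
  simp only [CanMoveDown, mem_moveDown] at h ⊢
  grind

theorem canMoveDown_moveDown (h : i ≠ j) (h₁ : j ≠ i + n) (h₂ : i ≠ j + n) :
    CanMoveDown n i (moveDown n j C) ↔ CanMoveDown n i C := by
  simp only [CanMoveDown, mem_moveDown]
  grind

theorem beadsBetween_moveDown_of_far (h : i + n < j ∨ j + n < i) :
    beadsBetween n i (moveDown n j C) = beadsBetween n i C := by
  unfold beadsBetween
  congr 1
  ext t
  simp only [mem_moveDown, mem_filter, mem_Ioo]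
  grind

theorem beadsBetween_moveDown_of_lt (h : i < j) (h' : j < i + n) (hj : j ∉ C) :
    beadsBetween n i (moveDown n j C) = beadsBetween n i C + 1 := by
  classical
  unfold beadsBetween
  rw [← card_insert_of_notMem (a := j) (by simp [hj])]
  congr 1
  ext t
  simp only [mem_moveDown, mem_filter, mem_Ioo, mem_insert]
  grind

theorem beadsBetween_moveDown_of_gt (h : i < j) (h' : j < i + n) (hi : i + n ∈ C) :
    beadsBetween n j (moveDown n i C) + 1 = beadsBetween n j C := by
  classical
  unfold beadsBetween
  rw [← card_insert_of_notMem (a := i + n) (by simp; lia)]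
  congr 1
  ext t
  simp only [mem_moveDown, mem_filter, mem_Ioo, mem_insert]
  grind

theorem addRibbon_mul_self (i : ℤ) : addRibbon n q i * addRibbon n q i = 0 := by
  ext v C
  simp [addRibbon_apply, not_canMoveDown_moveDown_self]

theorem addRibbon_mul_mul_self (i j : ℤ) :
    addRibbon n q i * addRibbon n q j * addRibbon n q i = 0 := by
  ext v C
  simp +contextual [addRibbon_apply, not_canMoveDown_moveDown_moveDown]

theorem addRibbon_commute_of_far (h : i + n < j) :
    Commute (addRibbon n q i) (addRibbon n q j) := by
  have h₁ : j ≠ i + n := by lia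
  have h₂ : i ≠ j + n := by lia
  ext v C
  simp only [Module.End.mul_apply, addRibbon_apply]
  rw [canMoveDown_moveDown (by lia) h₂ h₁, canMoveDown_moveDown (by lia) h₁ h₂,
    beadsBetween_moveDown_of_far (.inl h), beadsBetween_moveDown_of_far (.inr h),
    moveDown_comm h₁ h₂]
  split_ifs <;> ring

theorem addRibbon_mul_addRibbon_of_lt (h : i < j) (h' : j < i + n) :
    addRibbon n q j * addRibbon n q i = q ^ 2 • (addRibbon n q i * addRibbon n q j) := by
  have h₁ : j ≠ i + n := by lia
  have h₂ : i ≠ j + n := by lia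
  ext v C
  simp only [Module.End.mul_apply, addRibbon_apply, LinearMap.smul_apply, Pi.smul_apply,
    smul_eq_mul]
  rw [canMoveDown_moveDown (by lia) h₂ h₁, canMoveDown_moveDown (by lia) h₁ h₂,
    moveDown_comm h₁ h₂]
  split_ifs with hj hi
  · rw [beadsBetween_moveDown_of_lt h h' hj.1, ← beadsBetween_moveDown_of_gt h h' hi.2]
    ring
  all_goals simp

theorem addRibbon_commute_mul_of_lt {m : ℤ} (hi : i < m) (hj : m < j) (h : j ≤ i + n) :
    Commute (addRibbon n q m) (addRibbon n q i * addRibbon n q j) := by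
  rw [commute_iff_eq, ← mul_assoc, addRibbon_mul_addRibbon_of_lt hi (by lia), smul_mul_assoc,
    mul_assoc, ← mul_smul_comm, ← addRibbon_mul_addRibbon_of_lt hj (by lia), mul_assoc]

theorem addRibbon_commute_mul_of_gt (hq : IsLeftRegular q) {m : ℤ} (hi : i < m) (hj : m < j)
    (h : j ≤ i + n) : Commute (addRibbon n q m) (addRibbon n q j * addRibbon n q i) := by
  have scaled : q ^ 2 • (addRibbon n q m * (addRibbon n q j * addRibbon n q i)) =
      q ^ 2 • (addRibbon n q j * addRibbon n q i * addRibbon n q m) := by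
    rw [← mul_assoc, ← smul_mul_assoc, ← addRibbon_mul_addRibbon_of_lt hj (by lia), mul_assoc,
      addRibbon_mul_addRibbon_of_lt hi (by lia), mul_smul_comm, mul_assoc]
  ext v C
  exact hq.pow 2 (congrFun (LinearMap.congr_fun scaled v) C)

theorem ribbonRelations_addRibbon (n : ℕ) (hq : IsLeftRegular q) :
    RibbonRelations (addRibbon n q) where
  mul_self := addRibbon_mul_self
  mul_mul_self := addRibbon_mul_mul_self
  commute_lie i m j hi hj := by
    rw [Ring.lie_def]
    rcases lt_or_ge (i + n) j with hfar | hnear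
    · rw [(addRibbon_commute_of_far hfar).eq, sub_self]
      exact Commute.zero_right _
    · exact (addRibbon_commute_mul_of_lt hi hj hnear).sub_right
        (addRibbon_commute_mul_of_gt hq hi hj hnear)

end Beads

/-! ### Ribbons as lattice paths -/

section Paths

/-- The content of a box. -/
def content (c : ℕ × ℕ) : ℤ := c.2 - c.1

/-- The smallest content of a box of `R`. -/
noncomputable def tail (R : Finset (ℕ × ℕ)) : ℤ := sInf (content '' (R : Set (ℕ × ℕ)))

/-- `R` is a lattice path of `n` boxes, with steps up and to the right, that starts at
content `t`. -/
structure IsPath (n : ℕ) (R : Finset (ℕ × ℕ)) (t : ℤ) : Prop where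
  image_content : R.image content = Ico t (t + n)
  injOn : Set.InjOn content R
  step : ∀ c ∈ R, ∀ d ∈ R, content d = content c + 1 → d.1 = c.1 ∨ d.1 + 1 = c.1

variable {n : ℕ} {R : Finset (ℕ × ℕ)} {t : ℤ} {c d : ℕ × ℕ}

theorem tail_le_content (hc : c ∈ R) : tail R ≤ content c :=
  csInf_le (R.finite_toSet.image content).bddBelow (Set.mem_image_of_mem content hc)

theorem exists_content_eq_tail (hR : R.Nonempty) : ∃ c ∈ R, content c = tail R :=
  (hR.to_set.image content).csInf_mem (R.finite_toSet.image content)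

namespace IsPath

theorem content_mem (h : IsPath n R t) (hc : c ∈ R) : t ≤ content c ∧ content c < t + n :=
  mem_Ico.1 (h.image_content ▸ mem_image_of_mem content hc)

theorem exists_mem (h : IsPath n R t) {s : ℤ} (hs : t ≤ s) (hs' : s < t + n) :
    ∃ c ∈ R, content c = s :=
  mem_image.1 (h.image_content ▸ mem_Ico.2 ⟨hs, hs'⟩)

theorem card_eq (h : IsPath n R t) : R.card = n := by
  rw [← card_image_of_injOn h.injOn, h.image_content]
  simp

theorem pos_of_mem (h : IsPath n R t) (hc : c ∈ R) : 1 ≤ n :=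
  h.card_eq ▸ card_pos.2 ⟨c, hc⟩

theorem tail_eq (h : IsPath n R t) (hn : 1 ≤ n) : tail R = t := by
  obtain ⟨c, hc, hct⟩ := h.exists_mem le_rfl (by lia)
  obtain ⟨d, hd, hdt⟩ := exists_content_eq_tail ⟨c, hc⟩
  exact le_antisymm (hct ▸ tail_le_content hc) (hdt ▸ (h.content_mem hd).1)

end IsPath

theorem IsSkewShape.ordConnected (h : IsSkewShape R) : (R : Set (ℕ × ℕ)).OrdConnected := by
  obtain ⟨lam, mu, -, rfl⟩ := h
  rw [skewCells, coe_sdiff, Set.sdiff_eq]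
  exact lam.isLowerSet.ordConnected.inter mu.isLowerSet.compl.ordConnected

theorem hasse_adj_iff : (SimpleGraph.hasse (ℕ × ℕ)).Adj c d ↔
    (d.1 = c.1 ∧ (d.2 = c.2 + 1 ∨ c.2 = d.2 + 1)) ∨
      (d.2 = c.2 ∧ (d.1 = c.1 + 1 ∨ c.1 = d.1 + 1)) := by
  obtain ⟨a, b⟩ := c
  obtain ⟨a', b'⟩ := d
  simp only [SimpleGraph.hasse_adj, Prod.mk_covBy_mk_iff, Nat.covBy_iff_add_one_eq]
  lia

theorem exists_apply_eq_of_preconnected {V : Type*} {G : SimpleGraph V} (hG : G.Preconnected)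
    {f : V → ℤ} (hf : ∀ u v, G.Adj u v → f v ≤ f u + 1) {u v : V} (hu : f u ≤ t)
    (hv : t ≤ f v) : ∃ w, f w = t := by
  rcases hv.eq_or_lt with rfl | hv
  · exact ⟨v, rfl⟩
  obtain ⟨p⟩ := hG u v
  obtain ⟨e, -, he, he'⟩ := p.exists_boundary_dart {w | f w ≤ t} hu (not_le.2 hv)
  refine ⟨e.fst, ?_⟩
  have := hf _ _ e.adj
  simp only [Set.mem_ofPred_eq] at he he'
  lia

namespace IsRibbon

theorem nonempty (h : IsRibbon n R) : R.Nonempty :=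
  let ⟨⟨c, hc⟩⟩ := h.connected.nonempty
  ⟨c, hc⟩

theorem pos (h : IsRibbon n R) : 1 ≤ n := h.card_eq ▸ card_pos.2 h.nonempty

theorem not_snd_lt_of_fst_lt (h : IsRibbon n R) (hc : c ∈ R) (hd : d ∈ R) (h₁ : c.1 < d.1) :
    ¬ c.2 < d.2 := by
  intro h₂
  have mem {a b : ℕ} (hca : c ≤ (a, b)) (had : (a, b) ≤ d) : (a, b) ∈ R :=
    h.isSkewShape.ordConnected.out hc hd ⟨hca, had⟩
  refine h.no_square c.1 c.2 ⟨hc, mem ?_ ?_, mem ?_ ?_, mem ?_ ?_⟩ <;>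
    simp only [Prod.le_def] <;> lia

theorem injOn_content (h : IsRibbon n R) : Set.InjOn content R := by
  intro c hc d hd hcd
  have h₁ := h.not_snd_lt_of_fst_lt hc hd
  have h₂ := h.not_snd_lt_of_fst_lt hd hc
  simp only [content] at hcd
  ext <;> lia

theorem exists_content_eq (h : IsRibbon n R) (hc : c ∈ R) (hd : d ∈ R) (hct : content c ≤ t)
    (htd : t ≤ content d) : ∃ e ∈ R, content e = t := by
  obtain ⟨e, he⟩ := exists_apply_eq_of_preconnected h.connected.preconnected
    (f := fun e => content e) (u := ⟨c, hc⟩) (v := ⟨d, hd⟩) (fun u v huv => by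
      have := hasse_adj_iff.1 (SimpleGraph.induce_adj.1 huv)
      simp only [content]
      lia) hct htd
  exact ⟨e, e.2, he⟩

theorem image_content (h : IsRibbon n R) : R.image content = Ico (tail R) (tail R + n) := by
  obtain ⟨c, hc, hct⟩ := exists_content_eq_tail h.nonempty
  obtain ⟨d, hd, hmax⟩ := R.exists_max_image content h.nonempty
  have himage : R.image content = Icc (tail R) (content d) := by
    ext t
    rw [mem_image, mem_Icc]
    constructor
    · rintro ⟨e, he, rfl⟩
      exact ⟨tail_le_content he, hmax e he⟩
    · rintro ⟨h₁, h₂⟩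
      exact h.exists_content_eq hc hd (hct.trans_le h₁) h₂
  have hcard := card_image_of_injOn h.injOn_content
  rw [himage, h.card_eq, Int.card_Icc] at hcard
  have := tail_le_content hd
  rw [himage]
  ext t
  rw [mem_Icc, mem_Ico]
  lia

theorem isPath_tail (h : IsRibbon n R) : IsPath n R (tail R) where
  image_content := h.image_content
  injOn := h.injOn_content
  step c hc d hd hcd := by
    have h₁ := h.not_snd_lt_of_fst_lt hc hd
    have h₂ := h.not_snd_lt_of_fst_lt hd hc
    simp only [content] at hcd
    lia

end IsRibbon

theorem IsPath.hasse_adj (h : IsPath n R t) (hc : c ∈ R) (hd : d ∈ R)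
    (hcd : content d = content c + 1) : (SimpleGraph.hasse (ℕ × ℕ)).Adj c d := by
  have := h.step c hc d hd hcd
  simp only [content] at hcd
  rw [hasse_adj_iff]
  lia

theorem IsPath.connected (h : IsPath n R t) (hn : 1 ≤ n) :
    ((SimpleGraph.hasse (ℕ × ℕ)).induce (R : Set (ℕ × ℕ))).Connected := by
  rw [SimpleGraph.connected_iff_exists_forall_reachable]
  obtain ⟨c, hc, hct⟩ := h.exists_mem le_rfl (by lia)
  have reachable (k : ℕ) : ∀ d (hd : d ∈ R), content d = t + k →
      ((SimpleGraph.hasse (ℕ × ℕ)).induce (R : Set (ℕ × ℕ))).Reachable ⟨c, hc⟩ ⟨d, hd⟩ := by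
    induction k with
    | zero =>
      intro d hd hdt
      obtain rfl := h.injOn hc hd (by simp [hct, hdt])
      rfl
    | succ k ih =>
      intro d hd hdt
      obtain ⟨e, he, het⟩ := h.exists_mem (s := t + k) (by lia) (by have := h.content_mem hd; lia)
      have hed := h.hasse_adj he hd (by lia)
      exact (ih e he het).trans (SimpleGraph.Adj.reachable (SimpleGraph.induce_adj.2 hed))
  refine ⟨⟨c, hc⟩, fun ⟨d, hd⟩ => reachable (content d - t).toNat d hd ?_⟩
  have := h.content_mem hd
  lia

theorem IsPath.isRibbon (h : IsPath n R t) (hn : 1 ≤ n) (hR : IsSkewShape R) : IsRibbon n R where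
  isSkewShape := hR
  card_eq := h.card_eq
  connected := h.connected hn
  no_square a b := by
    rintro ⟨h₁, -, -, h₂⟩
    have := h.injOn h₁ h₂ (by simp [content])
    simp at this

end Paths

/-! ### Young diagrams along diagonals -/

section DiagRow

theorem exists_diagonal_notMem (lam : YoungDiagram) (t : ℤ) :
    ∃ m : ℕ, ¬ ∀ j : ℕ, (j : ℤ) = m + t → (m, j) ∈ lam := by
  refine ⟨max (lam.colLen 0) (-t).toNat, fun h => ?_⟩
  have hmem := h (max (lam.colLen 0) (-t).toNat + t).toNat (by lia)
  have := YoungDiagram.mem_iff_lt_colLen.1 (lam.up_left_mem le_rfl (Nat.zero_le _) hmem)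
  lia

open Classical in
/-- The first row in which the diagonal of content `t` is outside the diagram `lam`. Boxes to the
left of the first column count as boxes of `lam`. -/
noncomputable def diagRow (lam : YoungDiagram) (t : ℤ) : ℕ :=
  Nat.find (exists_diagonal_notMem lam t)

variable {lam nu : YoungDiagram} {t : ℤ} {c : ℕ × ℕ}

theorem lt_diagRow_iff {m : ℕ} :
    m < diagRow lam t ↔ ∀ j : ℕ, (j : ℤ) = m + t → (m, j) ∈ lam := by
  classical
  rw [diagRow, Nat.lt_find_iff]
  simp only [not_not]
  exact ⟨fun h => h m le_rfl, fun h k hk j hj =>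
    lam.up_left_mem hk (by lia) (h (j + (m - k)) (by lia))⟩

theorem mem_iff_lt_diagRow : c ∈ lam ↔ c.1 < diagRow lam (content c) := by
  rw [lt_diagRow_iff]
  refine ⟨fun h j hj => ?_, fun h => h c.2 (by simp [content])⟩
  obtain rfl : j = c.2 := by simp only [content] at hj; lia
  exact h

theorem neg_le_diagRow (lam : YoungDiagram) (t : ℤ) : -t ≤ diagRow lam t := by
  by_contra! h
  exact lt_irrefl _ (lt_diagRow_iff.2 fun j (hj : (j : ℤ) = diagRow lam t + t) => by lia)

theorem diagRow_antitone (lam : YoungDiagram) : Antitone (diagRow lam) := by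
  refine antitone_int_of_succ_le fun t => ?_
  by_contra! h
  refine lt_irrefl _ (lt_diagRow_iff.2 fun j (hj : (j : ℤ) = diagRow lam t + t) => ?_)
  exact lam.up_left_mem le_rfl (Nat.le_succ j) (lt_diagRow_iff.1 h (j + 1) (by lia))

theorem add_diagRow_monotone (lam : YoungDiagram) : Monotone fun t : ℤ => t + diagRow lam t := by
  refine monotone_int_of_le_succ fun t => ?_
  by_contra! h
  refine lt_irrefl _ (lt_diagRow_iff.2 fun j (hj : (j : ℤ) = diagRow lam (t + 1) + (t + 1)) => ?_)
  exact lam.up_left_mem (Nat.le_succ _) le_rfl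
    (lt_diagRow_iff.1 (by lia : diagRow lam (t + 1) + 1 < diagRow lam t) j (by lia))

theorem diagRow_eq_zero (ht : (lam.rowLen 0 : ℤ) ≤ t) : diagRow lam t = 0 := by
  by_contra h
  have := YoungDiagram.mem_iff_lt_rowLen.1
    (lt_diagRow_iff.1 (Nat.pos_of_ne_zero h) t.toNat (by lia))
  lia

theorem le_iff_diagRow_le : nu ≤ lam ↔ ∀ t, diagRow nu t ≤ diagRow lam t := by
  constructor
  · intro h t
    by_contra! hlt
    exact lt_irrefl _ (lt_diagRow_iff.2 fun j hj => h (lt_diagRow_iff.1 hlt j hj))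
  · intro h c hc
    exact mem_iff_lt_diagRow.2 ((mem_iff_lt_diagRow.1 hc).trans_le (h _))

theorem diagRow_injective : Function.Injective diagRow := fun _ _ h =>
  le_antisymm (le_iff_diagRow_le.2 fun t => (congrFun h t).le)
    (le_iff_diagRow_le.2 fun t => (congrFun h t).ge)

theorem exists_diagRow_eq {f : ℤ → ℕ} (hf : Antitone f) (hf' : Monotone fun t : ℤ => t + f t)
    (hneg : ∀ t, -t ≤ f t) (hle : ∀ t, f t ≤ diagRow lam t) :
    ∃ nu : YoungDiagram, diagRow nu = f := by
  let nu : YoungDiagram :=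
    { cells := lam.cells.filter fun c => c.1 < f (content c)
      isLowerSet := by
        intro d c hcd hd
        rw [mem_coe, mem_filter] at hd ⊢
        refine ⟨lam.isLowerSet hcd hd.1, ?_⟩
        have := hcd.1
        have := hcd.2
        have h₁ := hf (show content c ≤ content d + (d.1 - c.1) by simp only [content]; lia)
        have h₂ := hf' (show content d ≤ content d + (d.1 - c.1) by lia)
        dsimp only at h₂
        lia }
  have mem_nu (c : ℕ × ℕ) : c ∈ nu ↔ c.1 < f (content c) := by
    rw [← YoungDiagram.mem_cells, mem_filter, YoungDiagram.mem_cells, mem_iff_lt_diagRow]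
    exact and_iff_right_of_imp fun h => h.trans_le (hle _)
  refine ⟨nu, funext fun t => eq_of_forall_lt_iff fun m => ?_⟩
  rw [lt_diagRow_iff]
  have hcontent {j : ℕ} (hj : (j : ℤ) = m + t) : content (m, j) = t := by
    simp only [content]; lia
  have := hneg t
  constructor
  · intro h
    by_cases hm : 0 ≤ (m : ℤ) + t
    · have := (mem_nu _).1 (h (m + t).toNat (by lia))
      rwa [hcontent (by lia)] at this
    · lia
  · intro h j hj
    rwa [mem_nu, hcontent hj]

/-- The vertical steps of the boundary of `lam`, as positions of beads. -/
def beads (lam : YoungDiagram) : Set ℤ := {t | diagRow lam (t - 1) = diagRow lam t + 1}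

theorem mem_beads : t ∈ beads lam ↔ diagRow lam (t - 1) = diagRow lam t + 1 := Iff.rfl

theorem notMem_beads : t ∉ beads lam ↔ diagRow lam (t - 1) = diagRow lam t := by
  have h₁ := diagRow_antitone lam (sub_one_lt t).le
  have h₂ := add_diagRow_monotone lam (sub_one_lt t).le
  dsimp only at h₂
  rw [mem_beads]
  lia

open Classical in
theorem diagRow_eq_add_card_beads (lam : YoungDiagram) (t : ℤ) (k : ℕ) :
    diagRow lam t = diagRow lam (t + k) + ((Ioc t (t + k)).filter (· ∈ beads lam)).card := by
  induction k with
  | zero => simp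
  | succ k ih =>
    have hIoc : Ioc t (t + (k + 1 : ℕ)) = insert (t + k + 1) (Ioc t (t + k)) := by
      ext
      simp only [mem_Ioc, mem_insert]
      lia
    rw [hIoc, filter_insert, ih, Nat.cast_succ, ← add_assoc]
    split_ifs with hb
    · rw [card_insert_of_notMem (by simp)]
      rw [mem_beads, add_sub_cancel_right] at hb
      lia
    · rw [notMem_beads, add_sub_cancel_right] at hb
      rw [hb]

theorem beads_injective : Function.Injective beads := by
  intro nu lam h
  refine diagRow_injective (funext fun t => ?_)
  have hk : max (nu.rowLen 0 : ℤ) (lam.rowLen 0) ≤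
      t + (max (nu.rowLen 0 : ℤ) (lam.rowLen 0) - t).toNat := by lia
  rw [diagRow_eq_add_card_beads nu, diagRow_eq_add_card_beads lam, h,
    diagRow_eq_zero ((le_max_left _ _).trans hk), diagRow_eq_zero ((le_max_right _ _).trans hk)]

theorem image_diagRow_Icc (lam : YoungDiagram) (t : ℤ) (k : ℕ) :
    (Icc t (t + k)).image (diagRow lam) = Icc (diagRow lam (t + k)) (diagRow lam t) := by
  ext m
  simp only [mem_image, mem_Icc]
  constructor
  · rintro ⟨s, ⟨h₁, h₂⟩, rfl⟩
    exact ⟨diagRow_antitone lam h₂, diagRow_antitone lam h₁⟩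
  · rintro ⟨h₁, h₂⟩
    induction k with
    | zero => exact ⟨t, by simp, by simp_all; lia⟩
    | succ k ih =>
      by_cases hm : diagRow lam (t + k) ≤ m
      · obtain ⟨s, hs, rfl⟩ := ih hm
        exact ⟨s, by lia, rfl⟩
      · have := add_diagRow_monotone lam (show t + k ≤ t + (k + 1 : ℕ) by lia)
        dsimp only at this
        exact ⟨t + (k + 1 : ℕ), by lia, by lia⟩

end DiagRow

/-! ### Adding a ribbon to a Young diagram -/

section RibbonStep

variable {n : ℕ} {i t : ℤ} {lam nu : YoungDiagram} {c : ℕ × ℕ}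

/-- `lam` arises from `nu` by adding one box on each of the diagonals `i, …, i + n - 1`, that is,
by adding an `n`-ribbon whose smallest content is `i`. -/
structure IsRibbonStep (n : ℕ) (i : ℤ) (nu lam : YoungDiagram) : Prop where
  pos : 1 ≤ n
  diagRow_eq : ∀ t, diagRow lam t = diagRow nu t + if i ≤ t ∧ t < i + n then 1 else 0

theorem mem_skewCells : c ∈ skewCells lam nu ↔
    diagRow nu (content c) ≤ c.1 ∧ c.1 < diagRow lam (content c) := by
  rw [skewCells, mem_sdiff, YoungDiagram.mem_cells, YoungDiagram.mem_cells, mem_iff_lt_diagRow,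
    mem_iff_lt_diagRow, not_lt, and_comm]

theorem exists_mem_skewCells {m : ℕ} (h₁ : diagRow nu t ≤ m) (h₂ : m < diagRow lam t) :
    ∃ c ∈ skewCells lam nu, content c = t ∧ c.1 = m := by
  have := neg_le_diagRow nu t
  have hc : content (m, (m + t).toNat) = t := by simp only [content]; lia
  exact ⟨_, mem_skewCells.2 (by rw [hc]; exact ⟨h₁, h₂⟩), hc, rfl⟩

theorem IsPath.isRibbonStep (hn : 1 ≤ n) (hle : nu ≤ lam) (h : IsPath n (skewCells lam nu) i) :
    IsRibbonStep n i nu lam := by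
  refine ⟨hn, fun t => ?_⟩
  have hmono := le_iff_diagRow_le.1 hle t
  split_ifs with ht
  · obtain ⟨c, hc, rfl⟩ := h.exists_mem ht.1 ht.2
    have hc' := mem_skewCells.1 hc
    by_contra hne
    obtain ⟨d, hd, hdc, hd₁⟩ := exists_mem_skewCells (nu := nu) (lam := lam)
      (t := content c) le_rfl (by lia)
    obtain ⟨e, he, hec, he₁⟩ := exists_mem_skewCells (nu := nu) (lam := lam)
      (t := content c) (Nat.le_succ _) (by lia)
    obtain rfl := h.injOn hd he (hdc.trans hec.symm)
    lia
  · by_contra hne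
    obtain ⟨d, hd, rfl, -⟩ := exists_mem_skewCells (nu := nu) (lam := lam) le_rfl
      (show diagRow nu t < diagRow lam t by lia)
    exact ht (h.content_mem hd)

namespace IsRibbonStep

theorem le (h : IsRibbonStep n i nu lam) : nu ≤ lam :=
  le_iff_diagRow_le.2 fun t => by rw [h.diagRow_eq t]; exact Nat.le_add_right _ _

theorem eq_left {nu' : YoungDiagram} (h : IsRibbonStep n i nu lam)
    (h' : IsRibbonStep n i nu' lam) : nu = nu' :=
  diagRow_injective (funext fun t =>
    Nat.add_right_cancel ((h.diagRow_eq t).symm.trans (h'.diagRow_eq t)))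

theorem diagRow_eq_of_mem (h : IsRibbonStep n i nu lam) (ht : i ≤ t) (ht' : t < i + n) :
    diagRow lam t = diagRow nu t + 1 := by
  rw [h.diagRow_eq, if_pos ⟨ht, ht'⟩]

theorem diagRow_eq_of_notMem (h : IsRibbonStep n i nu lam) (ht : t < i ∨ i + n ≤ t) :
    diagRow lam t = diagRow nu t := by
  rw [h.diagRow_eq, if_neg (by lia), add_zero]

theorem mem_skewCells_iff (h : IsRibbonStep n i nu lam) : c ∈ skewCells lam nu ↔
    c.1 = diagRow nu (content c) ∧ i ≤ content c ∧ content c < i + n := by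
  rw [mem_skewCells, h.diagRow_eq]
  split_ifs <;> lia

theorem isPath (h : IsRibbonStep n i nu lam) : IsPath n (skewCells lam nu) i where
  image_content := by
    ext t
    simp only [mem_image, mem_Ico]
    constructor
    · rintro ⟨c, hc, rfl⟩
      exact (h.mem_skewCells_iff.1 hc).2
    · rintro ⟨h₁, h₂⟩
      obtain ⟨c, hc, hct, -⟩ := exists_mem_skewCells (nu := nu) (lam := lam) le_rfl
        (by rw [h.diagRow_eq_of_mem h₁ h₂]; lia)
      exact ⟨c, hc, hct⟩
  injOn c hc d hd hcd := by
    have h₁ := (h.mem_skewCells_iff.1 hc).1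
    have h₂ := (h.mem_skewCells_iff.1 hd).1
    rw [hcd] at h₁
    simp only [content] at hcd
    ext <;> lia
  step c hc d hd hcd := by
    have h₁ := (h.mem_skewCells_iff.1 hc).1
    have h₂ := (h.mem_skewCells_iff.1 hd).1
    have h₃ := diagRow_antitone nu (show content c ≤ content d by lia)
    have h₄ := add_diagRow_monotone nu (show content c ≤ content d by lia)
    dsimp only at h₄
    lia

theorem isRibbon (h : IsRibbonStep n i nu lam) : IsRibbon n (skewCells lam nu) :=
  h.isPath.isRibbon h.pos ⟨lam, nu, h.le, rfl⟩

theorem tail_eq (h : IsRibbonStep n i nu lam) : tail (skewCells lam nu) = i :=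
  h.isPath.tail_eq h.pos

theorem canMoveDown_beads (h : IsRibbonStep n i nu lam) : CanMoveDown n i (beads lam) := by
  have hn := h.pos
  constructor
  · rw [mem_beads, h.diagRow_eq_of_notMem (by lia), h.diagRow_eq_of_mem le_rfl (by lia)]
    have := add_diagRow_monotone nu (sub_one_lt i).le
    dsimp only at this
    lia
  · rw [← not_not (a := _ ∈ _), notMem_beads, h.diagRow_eq_of_mem (by lia) (by lia),
      h.diagRow_eq_of_notMem (by lia)]
    have := diagRow_antitone nu (sub_one_lt (i + n)).le
    lia

theorem mem_beads_iff (h : IsRibbonStep n i nu lam) (hi : t ≠ i) (hin : t ≠ i + n) :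
    t ∈ beads lam ↔ t ∈ beads nu := by
  rw [mem_beads, mem_beads, h.diagRow_eq, h.diagRow_eq]
  split_ifs <;> lia

theorem moveDown_beads (h : IsRibbonStep n i nu lam) : moveDown n i (beads lam) = beads nu := by
  have hn := h.pos
  obtain ⟨hi, hin⟩ := h.canMoveDown_beads
  have hi' : i ∈ beads nu := by
    rw [notMem_beads, h.diagRow_eq_of_notMem (by lia), h.diagRow_eq_of_mem le_rfl (by lia)] at hi
    exact hi
  have hin' : i + n ∉ beads nu := by
    rw [mem_beads, h.diagRow_eq_of_mem (by lia) (by lia), h.diagRow_eq_of_notMem (by lia)] at hin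
    exact notMem_beads.2 (Nat.add_right_cancel hin)
  ext t
  rw [mem_moveDown]
  rcases eq_or_ne t i with rfl | hti
  · simp [hi']
  rcases eq_or_ne t (i + n) with rfl | htn
  · simp only [hin', hti, ne_eq, not_true, and_false, or_self]
  · rw [h.mem_beads_iff hti htn]
    simp [hti, htn]

theorem image_fst_skewCells (h : IsRibbonStep n i nu lam) :
    (skewCells lam nu).image Prod.fst = (Ico i (i + n)).image (diagRow nu) := by
  rw [← h.isPath.image_content, image_image]
  exact image_congr fun c hc => (h.mem_skewCells_iff.1 hc).1

theorem spin_eq (h : IsRibbonStep n i nu lam) :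
    spin (skewCells lam nu) = beadsBetween n i (beads lam) := by
  classical
  obtain ⟨k, rfl⟩ := Nat.exists_eq_add_of_le' h.pos
  have hIco : Ico i (i + (k + 1 : ℕ)) = Icc i (i + k) := by
    ext
    simp only [mem_Ico, mem_Icc]
    lia
  have hbeads : (Ioo i (i + (k + 1 : ℕ))).filter (· ∈ beads lam) =
      (Ioc i (i + k)).filter (· ∈ beads nu) := by
    ext t
    simp only [mem_filter, mem_Ioo, mem_Ioc]
    have := h.mem_beads_iff (t := t)
    grind
  have := diagRow_eq_add_card_beads nu i k
  have hcard : diagRow nu i + 1 - diagRow nu (i + k) - 1 =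
      ((Ioc i (i + k)).filter (· ∈ beads nu)).card := by lia
  rw [spin, h.image_fst_skewCells, hIco, image_diagRow_Icc, Nat.card_Icc, beadsBetween, hcard,
    ← hbeads]

end IsRibbonStep

theorem CanMoveDown.one_le_diagRow (h : CanMoveDown n i (beads lam)) (ht : t < i + n) :
    1 ≤ diagRow lam t := by
  have := mem_beads.1 h.2
  have := diagRow_antitone lam (show t ≤ i + n - 1 by lia)
  lia

theorem CanMoveDown.one_le_add_diagRow (h : CanMoveDown n i (beads lam)) (ht : i ≤ t) :
    1 ≤ t + diagRow lam t := by
  have := notMem_beads.1 h.1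
  have := neg_le_diagRow lam (i - 1)
  have := add_diagRow_monotone lam ht
  dsimp only at this
  lia

theorem exists_isRibbonStep (h : CanMoveDown n i (beads lam)) :
    ∃ nu, IsRibbonStep n i nu lam := by
  have hn : 1 ≤ n := Nat.one_le_iff_ne_zero.2 fun hn => h.1 (by simpa [hn] using h.2)
  let f (t : ℤ) : ℕ := diagRow lam t - if i ≤ t ∧ t < i + n then 1 else 0
  have hpos (t : ℤ) : t < i + n → 1 ≤ diagRow lam t := h.one_le_diagRow
  have hf : Antitone f := antitone_int_of_succ_le fun t => by
    have := diagRow_antitone lam (show t ≤ t + 1 by lia)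
    have : t + 1 = i + n → diagRow lam t = diagRow lam (t + 1) + 1 := by
      intro ht
      rw [ht, ← mem_beads.1 h.2, ← ht, add_sub_cancel_right]
    dsimp only [f]
    split_ifs <;> lia
  have hf' : Monotone fun t : ℤ => t + (f t : ℤ) := monotone_int_of_le_succ fun t => by
    have hmono := add_diagRow_monotone lam (show t ≤ t + 1 by lia)
    have : t + 1 = i → diagRow lam t = diagRow lam (t + 1) := by
      intro ht
      rw [ht, ← notMem_beads.1 h.1, ← ht, add_sub_cancel_right]
    have := hpos (t + 1)
    dsimp only [f] at hmono ⊢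
    split_ifs <;> lia
  have hneg (t : ℤ) : -t ≤ f t := by
    have := neg_le_diagRow lam t
    have := h.one_le_add_diagRow (t := t)
    dsimp only [f]
    split_ifs <;> lia
  obtain ⟨nu, hnu⟩ := exists_diagRow_eq hf hf' hneg (lam := lam) fun t => Nat.sub_le _ _
  refine ⟨nu, hn, fun t => ?_⟩
  have := hpos t
  simp only [hnu, f]
  split_ifs <;> lia

end RibbonStep

/-! ### Ribbon strips -/

section Strips

variable {n : ℕ} {R R' : Finset (ℕ × ℕ)} {t t' : ℤ} {c c' d : ℕ × ℕ}

namespace IsPath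

theorem antitone_fst_and_monotone_snd (h : IsPath n R t) (hc : c ∈ R) (hd : d ∈ R)
    (hcd : content c ≤ content d) : d.1 ≤ c.1 ∧ c.2 ≤ d.2 := by
  obtain ⟨k, hk⟩ := Int.le.dest hcd
  induction k generalizing d with
  | zero => rw [h.injOn hc hd (by simpa using hk)]; simp
  | succ k ih =>
    have hc' := h.content_mem hc
    have hd' := h.content_mem hd
    obtain ⟨e, he, hec⟩ := h.exists_mem (s := content c + k) (by lia) (by lia)
    have hce := ih he (by lia) hec.symm
    have hed := h.step e he d hd (by lia)
    simp only [content] at hk hec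
    lia

theorem isTopRight_iff (h : IsPath n R t) : IsTopRight R c ↔ c ∈ R ∧ content c = t + n - 1 := by
  refine and_congr_right fun hc => ⟨fun hmax => ?_, fun hct d hd => ?_⟩
  · have hn := h.pos_of_mem hc
    obtain ⟨d, hd, hdt⟩ := h.exists_mem (s := t + n - 1) (by lia) (by lia)
    have hdc := hmax d hd
    have hc' := h.content_mem hc
    simp only [content] at *
    lia
  · have := h.content_mem hd
    exact h.antitone_fst_and_monotone_snd hd hc (by lia)

/-- Follow both paths to the right until the second one ends: as the paths do not meet, they do
not cross, and the end of the second path would lie below a box of `S`. -/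
theorem le_of_touchesNorth (h : IsPath n R t) (h' : IsPath n R' t') (htt : t' ≤ t)
    (hdisj : Disjoint R R') {S : Finset (ℕ × ℕ)} (hS : (S : Set (ℕ × ℕ)).OrdConnected)
    (hRS : R ⊆ S) (hRS' : R' ⊆ S) (hd : IsTopRight R' d) (hdS : TouchesNorth S d)
    (hc : c ∈ R) (hc' : c' ∈ R') (hcc : content c = content c') : c' ≤ c := by
  rw [h'.isTopRight_iff] at hd
  suffices ¬ c.1 < c'.1 by simp only [Prod.le_def, content] at *; lia
  intro hlt
  have hc₁ := h'.content_mem hc'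
  obtain ⟨k, hk⟩ := Int.le.dest (show content c' ≤ t' + n - 1 by lia)
  induction k generalizing c c' with
  | zero =>
    obtain rfl := h'.injOn hc' hd.1 (by lia)
    refine hdS (c'.1 - 1) (by lia) (mem_coe.1 (hS.out (hRS hc) (hRS' hc') ⟨?_, ?_⟩)) <;>
    · simp only [content, Prod.le_def] at *
      lia
  | succ k ih =>
    have hc₂ := h.content_mem hc
    obtain ⟨e, he, hec⟩ := h.exists_mem (s := content c + 1) (by lia) (by lia)
    obtain ⟨e', he', hec'⟩ := h'.exists_mem (s := content c' + 1) (by lia) (by lia)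
    have hstep := h.step c hc e he hec
    have hstep' := h'.step c' hc' e' he' hec'
    have hne : e.1 ≠ e'.1 := by
      intro hrow
      refine disjoint_left.1 hdisj he ?_
      rwa [show e = e' from Prod.ext hrow (by simp only [content] at *; lia)]
    exact ih he he' (by lia) (by lia) (h'.content_mem he') (by lia)

theorem not_covBy_of_touchesNorth (h : IsPath n R t) (h' : IsPath n R' t') (htt : t' ≤ t)
    (hdisj : Disjoint R R') {S : Finset (ℕ × ℕ)} (hS : (S : Set (ℕ × ℕ)).OrdConnected)
    (hRS : R ⊆ S) (hRS' : R' ⊆ S) (hd : IsTopRight R' d) (hdS : TouchesNorth S d)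
    (hc : c ∈ R) (hc' : c' ∈ R') : ¬ c ⋖ c' := by
  have hle {x y : ℕ × ℕ} (hx : x ∈ R) (hy : y ∈ R') (hxy : content x = content y) : y ≤ x :=
    h.le_of_touchesNorth h' htt hdisj hS hRS hRS' hd hdS hx hy hxy
  have hne {x y : ℕ × ℕ} (hx : x ∈ R) (hy : y ∈ R') : x ≠ y := fun hxy =>
    disjoint_left.1 hdisj hx (hxy ▸ hy)
  have hct := h.content_mem hc
  have hct' := h'.content_mem hc'
  obtain ⟨a, b⟩ := c
  obtain ⟨a', b'⟩ := c'
  rw [Prod.mk_covBy_mk_iff, Nat.covBy_iff_add_one_eq, Nat.covBy_iff_add_one_eq]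
  rintro (⟨rfl, rfl⟩ | ⟨rfl, rfl⟩)
  · by_cases hhead : content (a + 1, b) = t' + n - 1
    · obtain rfl := h'.injOn hc' hd.1 (hhead.trans (h'.isTopRight_iff.1 hd).2.symm)
      exact hdS a rfl (hRS hc)
    · obtain ⟨e, he, hec⟩ := h'.exists_mem (s := content (a, b))
        (by simp only [content] at *; lia) (by simp only [content] at *; lia)
      have hstep := h'.step _ hc' e he (by simp only [content] at *; lia)
      have hea := (hle hc he hec.symm).1
      refine hne hc he (Prod.ext ?_ ?_) <;>
      · simp only [content] at *
        lia
  · obtain ⟨e, he, hec⟩ := h.exists_mem (s := content (a, b + 1))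
      (by simp only [content] at *; lia) (by lia)
    have hstep := h.step _ hc e he (by simp only [content] at *; lia)
    have hae := (hle he hc' hec).1
    refine hne he hc' (Prod.ext ?_ ?_) <;>
    · simp only [content] at *
      lia

end IsPath

/-- The transpose of a set of boxes; it turns vertical ribbon strips into horizontal ones. -/
def transpose (R : Finset (ℕ × ℕ)) : Finset (ℕ × ℕ) := R.image Prod.swap

@[simp]
theorem mem_transpose : c ∈ transpose R ↔ c.swap ∈ R := by
  rw [transpose, mem_image]
  exact ⟨fun ⟨d, hd, hdc⟩ => by simpa [← hdc] using hd, fun hc => ⟨_, hc, c.swap_swap⟩⟩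

theorem content_swap (c : ℕ × ℕ) : content c.swap = -content c := by simp [content]

theorem IsPath.transpose (h : IsPath n R t) : IsPath n (transpose R) (1 - n - t) where
  image_content := by
    ext s
    simp only [mem_image, mem_transpose, mem_Ico]
    constructor
    · rintro ⟨c, hc, rfl⟩
      have := h.content_mem hc
      rw [content_swap] at this
      lia
    · rintro ⟨h₁, h₂⟩
      obtain ⟨c, hc, hcs⟩ := h.exists_mem (s := -s) (by lia) (by lia)
      exact ⟨c.swap, by simpa using hc, by rw [content_swap]; lia⟩
  injOn c hc d hd hcd := Prod.swap_injective <|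
    h.injOn (mem_transpose.1 hc) (mem_transpose.1 hd) (by rw [content_swap, content_swap, hcd])
  step c hc d hd hcd := by
    have := h.step _ (mem_transpose.1 hd) _ (mem_transpose.1 hc)
      (by rw [content_swap, content_swap]; lia)
    simp only [content, Prod.fst_swap] at *
    lia

theorem ordConnected_transpose (h : (R : Set (ℕ × ℕ)).OrdConnected) :
    (transpose R : Set (ℕ × ℕ)).OrdConnected := by
  rw [show (transpose R : Set (ℕ × ℕ)) = Prod.swap ⁻¹' R by ext; simp]
  exact h.preimage_mono fun _ _ hcd => Prod.swap_le_swap.2 hcd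

theorem isTopRight_transpose : IsTopRight (transpose R) c.swap ↔ IsBottomLeft R c := by
  simp only [IsTopRight, IsBottomLeft, transpose, forall_mem_image,
    Prod.swap_injective.mem_finset_image, Prod.fst_swap, Prod.snd_swap, and_comm]

theorem touchesNorth_transpose : TouchesNorth (transpose R) c.swap ↔ TouchesWest R c := by
  simp [TouchesNorth, TouchesWest]

variable {P Q : Finset (Finset (ℕ × ℕ))}

theorem sup_image_transpose : (P.image transpose).sup id = transpose (P.sup id) := by
  ext
  simp

theorem isHorizontalStrip_image_transpose :
    IsHorizontalStrip (P.image transpose) ↔ IsVerticalStrip P := by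
  simp only [IsHorizontalStrip, IsVerticalStrip, forall_mem_image, sup_image_transpose]
  refine forall₂_congr fun R _ => (Equiv.prodComm ℕ ℕ).exists_congr fun c => ?_
  rw [Equiv.prodComm_apply, ← isTopRight_transpose, ← touchesNorth_transpose, Prod.swap_swap]

namespace IsHorizontalStrip

theorem subset (h : IsHorizontalStrip P) (hQ : Q ⊆ P) : IsHorizontalStrip Q := fun R hR =>
  let ⟨c, hc, hcP⟩ := h R (hQ hR)
  ⟨c, hc, fun i hi hmem => hcP i hi (sup_mono (f := id) hQ hmem)⟩

theorem not_covBy (h : IsHorizontalStrip P) (hP : (↑(P.sup id) : Set (ℕ × ℕ)).OrdConnected)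
    (hR : R ∈ P) (hR' : R' ∈ P) (hdisj : Disjoint R R') (hpath : IsPath n R t)
    (hpath' : IsPath n R' t') (ht : t' ≤ t) (hc : c ∈ R) (hc' : c' ∈ R') : ¬ c ⋖ c' :=
  let ⟨_, hd, hdP⟩ := h R' hR'
  hpath.not_covBy_of_touchesNorth hpath' ht hdisj hP (le_sup (f := id) hR)
    (le_sup (f := id) hR') hd hdP hc hc'

theorem not_disjoint (h : IsHorizontalStrip P) (hn : 1 ≤ n)
    (hP : (↑(P.sup id) : Set (ℕ × ℕ)).OrdConnected) (hR : R ∈ P) (hR' : R' ∈ P)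
    (hpath : IsPath n R t) (hpath' : IsPath n R' t) : ¬ Disjoint R R' := by
  intro hdisj
  obtain ⟨c, hc, hct⟩ := hpath.exists_mem le_rfl (by lia)
  obtain ⟨c', hc', hct'⟩ := hpath'.exists_mem le_rfl (by lia)
  obtain ⟨d, hd, hdP⟩ := h R hR
  obtain ⟨d', hd', hdP'⟩ := h R' hR'
  have hRP : R ⊆ P.sup id := le_sup (f := id) hR
  have hRP' : R' ⊆ P.sup id := le_sup (f := id) hR'
  refine disjoint_left.1 hdisj hc ?_
  rwa [le_antisymm
    (hpath'.le_of_touchesNorth hpath le_rfl hdisj.symm hP hRP' hRP hd hdP hc' hc (by lia))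
    (hpath.le_of_touchesNorth hpath' le_rfl hdisj hP hRP hRP' hd' hdP' hc hc' (by lia))]

theorem insert (h : IsHorizontalStrip P) (hn : 1 ≤ n) (hpath : IsPath n R t)
    (hP : ∀ R' ∈ P, ∃ t' < t, IsPath n R' t')
    (hR : ∀ R' ∈ P, ∀ c ∈ R, ∀ c' ∈ R', ¬ c ≤ c') : IsHorizontalStrip (insert R P) := by
  intro R' hR'
  rw [sup_insert, id]
  rcases mem_insert.1 hR' with rfl | hR'
  · obtain ⟨c, hc, hct⟩ := hpath.exists_mem (s := t + n - 1) (by lia) (by lia)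
    refine ⟨c, hpath.isTopRight_iff.2 ⟨hc, hct⟩, fun i hi hmem => ?_⟩
    have hcontent : content (i, c.2) = t + n := by simp only [content] at *; lia
    rcases mem_union.1 hmem with hmem | hmem
    · exact (hcontent ▸ hpath.content_mem hmem).2.ne rfl
    · obtain ⟨Q, hQ, hmem⟩ := mem_sup.1 hmem
      obtain ⟨t', ht', hQt⟩ := hP Q hQ
      have := hQt.content_mem hmem
      lia
  · obtain ⟨c, hc, hcP⟩ := h R' hR'
    refine ⟨c, hc, fun i hi hmem => ?_⟩
    rcases mem_union.1 hmem with hmem | hmem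
    · exact hR R' hR' _ hmem c hc.1 (Prod.mk_le_mk.2 ⟨by lia, le_rfl⟩)
    · exact hcP i hi hmem

end IsHorizontalStrip

/-- Horizontal or vertical ribbon strips, according to the kind of the label. -/
def IsStrip (hor : Bool) (P : Finset (Finset (ℕ × ℕ))) : Prop :=
  if hor then IsHorizontalStrip P else IsVerticalStrip P

/-- The order in which the ribbons of a strip are added: by increasing smallest content in a
horizontal strip, by decreasing smallest content in a vertical strip. -/
def StripLT (hor : Bool) (t t' : ℤ) : Prop := if hor then t < t' else t' < t

namespace IsStrip

variable {hor : Bool}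

theorem iff_image_transpose :
    IsStrip false P ↔ IsStrip true (P.image transpose) :=
  isHorizontalStrip_image_transpose.symm

theorem subset (h : IsStrip hor P) (hQ : Q ⊆ P) : IsStrip hor Q := by
  cases hor
  · rw [iff_image_transpose] at h ⊢
    exact IsHorizontalStrip.subset h (image_subset_image hQ)
  · exact IsHorizontalStrip.subset h hQ

theorem not_covBy (h : IsStrip hor P) (hP : (↑(P.sup id) : Set (ℕ × ℕ)).OrdConnected)
    (hR : R ∈ P) (hR' : R' ∈ P) (hdisj : Disjoint R R') (hpath : IsPath n R t)
    (hpath' : IsPath n R' t') (ht : StripLT hor t' t) (hc : c ∈ R) (hc' : c' ∈ R') :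
    ¬ c ⋖ c' := by
  cases hor
  · rw [iff_image_transpose] at h
    rw [← Prod.swap_covBy_swap]
    exact IsHorizontalStrip.not_covBy h (sup_image_transpose ▸ ordConnected_transpose hP)
      (mem_image_of_mem _ hR) (mem_image_of_mem _ hR')
      ((disjoint_image Prod.swap_injective).2 hdisj) hpath.transpose hpath'.transpose
      (sub_le_sub_left (le_of_lt ht) _) (by simpa using hc) (by simpa using hc')
  · exact IsHorizontalStrip.not_covBy h hP hR hR' hdisj hpath hpath' (le_of_lt ht) hc hc'

theorem not_disjoint (h : IsStrip hor P) (hn : 1 ≤ n)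
    (hP : (↑(P.sup id) : Set (ℕ × ℕ)).OrdConnected) (hR : R ∈ P) (hR' : R' ∈ P)
    (hpath : IsPath n R t) (hpath' : IsPath n R' t) : ¬ Disjoint R R' := by
  cases hor
  · rw [iff_image_transpose] at h
    rw [← disjoint_image Prod.swap_injective]
    exact IsHorizontalStrip.not_disjoint h hn (sup_image_transpose ▸ ordConnected_transpose hP)
      (mem_image_of_mem _ hR) (mem_image_of_mem _ hR') hpath.transpose hpath'.transpose
  · exact IsHorizontalStrip.not_disjoint h hn hP hR hR' hpath hpath'

theorem insert (h : IsStrip hor P) (hn : 1 ≤ n) (hpath : IsPath n R t)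
    (hP : ∀ R' ∈ P, ∃ t', StripLT hor t' t ∧ IsPath n R' t')
    (hR : ∀ R' ∈ P, ∀ c ∈ R, ∀ c' ∈ R', ¬ c ≤ c') : IsStrip hor (insert R P) := by
  cases hor
  · rw [iff_image_transpose] at h ⊢
    rw [image_insert]
    refine IsHorizontalStrip.insert h hn hpath.transpose (forall_mem_image.2 fun R' hR' => ?_)
      (forall_mem_image.2 fun R' hR' c hc c' hc' => ?_)
    · obtain ⟨t', ht', hpath'⟩ := hP R' hR'
      exact ⟨_, sub_lt_sub_left ht' _, hpath'.transpose⟩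
    · rw [← Prod.swap_le_swap]
      exact hR R' hR' _ (mem_transpose.1 hc) _ (mem_transpose.1 hc')
  · exact IsHorizontalStrip.insert h hn hpath hP hR

end IsStrip

end Strips

/-! ### Labelled tilings and the order in which their ribbons are added -/

section Fillings

variable {α : Type*} [LinearOrder α]

/-- The ribbons with label `k` of a set of labelled ribbons. -/
def strip (F : Finset (α × Finset (ℕ × ℕ))) (k : α) : Finset (Finset (ℕ × ℕ)) :=
  (F.filter fun p => p.1 = k).image Prod.snd

/-- A super ribbon tableau of shape `lam / mu` with labels in an arbitrary linear order, presented
as the set of its labelled ribbons: `hor` tells which labels form horizontal strips. That the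
labels `≤ k` cover a skew shape `nu / mu` is expressed by the labels increasing along the order of
the boxes. -/
structure IsFilling (n : ℕ) (hor : α → Bool) (mu lam : YoungDiagram)
    (F : Finset (α × Finset (ℕ × ℕ))) : Prop where
  le : mu ≤ lam
  pairwiseDisjoint : (F : Set (α × Finset (ℕ × ℕ))).PairwiseDisjoint Prod.snd
  biUnion_eq : F.biUnion Prod.snd = skewCells lam mu
  isRibbon : ∀ p ∈ F, IsRibbon n p.2
  label_mono : ∀ p ∈ F, ∀ p' ∈ F, ∀ c ∈ p.2, ∀ c' ∈ p'.2, c ≤ c' → p.1 ≤ p'.1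
  isStrip : ∀ k, IsStrip (hor k) (strip F k)

/-- The step at which a labelled ribbon is added: its label and its smallest content. -/
noncomputable def step (p : α × Finset (ℕ × ℕ)) : α × ℤ := (p.1, tail p.2)

/-- The order of the steps: by label, and for equal labels as in a strip of the kind of the
label. -/
def StepLT (hor : α → Bool) (p p' : α × ℤ) : Prop :=
  p.1 < p'.1 ∨ (p.1 = p'.1 ∧ StripLT (hor p'.1) p.2 p'.2)

variable {n : ℕ} {hor : α → Bool} {mu nu lam : YoungDiagram} {F G : Finset (α × Finset (ℕ × ℕ))}
  {p p' : α × Finset (ℕ × ℕ)} {c c' : ℕ × ℕ} {k : α} {i : ℤ}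

@[simp]
theorem mem_strip {R : Finset (ℕ × ℕ)} : R ∈ strip F k ↔ (k, R) ∈ F := by
  simp [strip]

theorem strip_mono (h : F ⊆ G) : strip F k ⊆ strip G k :=
  image_subset_image (filter_subset_filter _ h)

theorem StepLT.label_le {p p' : α × ℤ} (h : StepLT hor p p') : p.1 ≤ p'.1 :=
  h.elim le_of_lt fun h => h.1.le

theorem StepLT.irrefl (p : α × ℤ) : ¬ StepLT hor p p := by
  rintro (h | ⟨-, h⟩)
  · exact lt_irrefl _ h
  · unfold StripLT at h
    split_ifs at h <;> exact lt_irrefl _ h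

namespace IsFilling

theorem mem_skewCells_iff (h : IsFilling n hor mu lam F) :
    c ∈ skewCells lam mu ↔ ∃ p ∈ F, c ∈ p.2 := by
  rw [← h.biUnion_eq, mem_biUnion]

theorem mem_and_notMem (h : IsFilling n hor mu lam F) (hp : p ∈ F) (hc : c ∈ p.2) :
    c ∈ lam ∧ c ∉ mu := by
  simpa [skewCells] using h.mem_skewCells_iff.2 ⟨p, hp, hc⟩

theorem eq_of_mem (h : IsFilling n hor mu lam F) (hp : p ∈ F) (hp' : p' ∈ F) (hc : c ∈ p.2)
    (hc' : c ∈ p'.2) : p = p' :=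
  h.pairwiseDisjoint.elim_finset hp hp' c hc hc'

theorem ordConnected_strip (h : IsFilling n hor mu lam F) (k : α) :
    (↑((strip F k).sup id) : Set (ℕ × ℕ)).OrdConnected := by
  have hskew := IsSkewShape.ordConnected ⟨lam, mu, h.le, rfl⟩
  refine ⟨fun x hx z hz y hy => ?_⟩
  simp only [mem_coe, mem_sup, mem_strip, id] at hx hz ⊢
  obtain ⟨R, hR, hxR⟩ := hx
  obtain ⟨R', hR', hzR'⟩ := hz
  obtain ⟨⟨k', R''⟩, hp, hyR''⟩ := h.mem_skewCells_iff.1 (hskew.out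
    (h.mem_skewCells_iff.2 ⟨_, hR, hxR⟩) (h.mem_skewCells_iff.2 ⟨_, hR', hzR'⟩) hy)
  obtain rfl : k' = k := le_antisymm (h.label_mono _ hp _ hR' y hyR'' z hzR' hy.2)
    (h.label_mono _ hR _ hp x hxR y hyR'' hy.1)
  exact ⟨R'', hp, hyR''⟩

theorem injOn_step (h : IsFilling n hor mu lam F) : Set.InjOn step (F : Set (α × _)) := by
  rintro ⟨k, R⟩ hp ⟨k', R'⟩ hp' hstep
  obtain ⟨rfl, htail⟩ := Prod.mk.inj hstep
  by_contra hne
  have hpath' := (h.isRibbon _ hp').isPath_tail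
  rw [← htail] at hpath'
  exact (h.isStrip k).not_disjoint (h.isRibbon _ hp).pos (h.ordConnected_strip k)
    (mem_strip.2 hp) (mem_strip.2 hp') (h.isRibbon _ hp).isPath_tail hpath'
    (h.pairwiseDisjoint hp hp' hne)

theorem not_covBy (h : IsFilling n hor mu lam F) (hp : p ∈ F) (hp' : p' ∈ F)
    (hlt : StepLT hor (step p') (step p)) (hc : c ∈ p.2) (hc' : c' ∈ p'.2) : ¬ c ⋖ c' := by
  intro hcc
  have hne : p ≠ p' := fun heq => StepLT.irrefl _ (heq ▸ hlt)
  rcases hlt with hlt | ⟨heq, hstrip⟩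
  · exact hlt.not_ge (h.label_mono p hp p' hp' c hc c' hc' hcc.le)
  · obtain ⟨k, R⟩ := p
    obtain ⟨k', R'⟩ := p'
    obtain rfl : k' = k := heq
    exact (h.isStrip k').not_covBy (h.ordConnected_strip k') (mem_strip.2 hp) (mem_strip.2 hp')
      (h.pairwiseDisjoint hp hp' hne) (h.isRibbon _ hp).isPath_tail
      (h.isRibbon _ hp').isPath_tail hstrip hc hc' hcc

theorem mem_of_le_of_forall_stepLT (h : IsFilling n hor mu lam F) (hp : p ∈ F)
    (hmax : ∀ p' ∈ F, p' ≠ p → StepLT hor (step p') (step p)) (hc : c ∈ p.2) (hc' : c' ∈ lam)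
    (hcc : c ≤ c') : c' ∈ p.2 := by
  induction le_iff_reflTransGen_covBy.1 hcc with
  | refl => exact hc
  | @tail d e hcd hde ih =>
    have hcd' := le_iff_reflTransGen_covBy.2 hcd
    have hd := ih (lam.isLowerSet hde.le hc') hcd'
    obtain ⟨p', hp', he⟩ := h.mem_skewCells_iff.1 (mem_sdiff.2
      ⟨hc', fun hmu => (h.mem_and_notMem hp hc).2 (mu.isLowerSet hcc hmu)⟩)
    by_contra hep
    exact h.not_covBy hp hp' (hmax p' hp' fun heq => hep (heq ▸ he)) hd he hde

theorem erase (h : IsFilling n hor mu lam F) (hp : p ∈ F)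
    (hmem : ∀ c, c ∈ nu ↔ c ∈ lam ∧ c ∉ p.2) : IsFilling n hor mu nu (F.erase p) where
  le c hc := (hmem c).2 ⟨h.le hc, fun hcp => (h.mem_and_notMem hp hcp).2 hc⟩
  pairwiseDisjoint := h.pairwiseDisjoint.subset (coe_subset.2 (erase_subset p F))
  biUnion_eq := by
    ext c
    have hc := h.mem_skewCells_iff (c := c)
    have heq := fun p' hp' hc' => h.eq_of_mem (p := p') (c := c) (p' := p) hp' hp hc'
    simp only [skewCells, mem_sdiff, YoungDiagram.mem_cells, mem_biUnion, mem_erase, hmem] at *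
    grind
  isRibbon p' hp' := h.isRibbon p' (mem_of_mem_erase hp')
  label_mono p₁ h₁ p₂ h₂ := h.label_mono p₁ (mem_of_mem_erase h₁) p₂ (mem_of_mem_erase h₂)
  isStrip k := (h.isStrip k).subset (strip_mono (erase_subset p F))

theorem exists_erase (h : IsFilling n hor mu lam F) (hp : p ∈ F)
    (hmax : ∀ p' ∈ F, p' ≠ p → StepLT hor (step p') (step p)) :
    ∃ nu, IsRibbonStep n (tail p.2) nu lam ∧ skewCells lam nu = p.2 ∧
      IsFilling n hor mu nu (F.erase p) := by
  let nu : YoungDiagram := ⟨lam.cells \ p.2, fun c' c hcc hc' => by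
    rw [mem_coe, mem_sdiff] at hc' ⊢
    exact ⟨lam.isLowerSet hcc hc'.1,
      fun hc => hc'.2 (h.mem_of_le_of_forall_stepLT hp hmax hc hc'.1 hcc)⟩⟩
  have hskew : skewCells lam nu = p.2 :=
    Finset.sdiff_sdiff_eq_self fun c hc => (h.mem_and_notMem hp hc).1
  have hribbon := h.isRibbon p hp
  exact ⟨nu, IsPath.isRibbonStep hribbon.pos sdiff_subset (hskew ▸ hribbon.isPath_tail), hskew,
    h.erase hp fun _ => mem_sdiff⟩

theorem isStrip_insert (h : IsFilling n hor mu nu F) (hstep : IsRibbonStep n i nu lam)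
    (hmax : ∀ p ∈ F, StepLT hor (step p) (k, i)) (k' : α) :
    IsStrip (hor k') (strip (insert (k, skewCells lam nu) F) k') := by
  rcases eq_or_ne k' k with rfl | hk
  · rw [show strip (insert (k', skewCells lam nu) F) k' = insert (skewCells lam nu) (strip F k') by
      simp [strip, filter_insert]]
    refine (h.isStrip k').insert hstep.pos hstep.isPath (fun R hR => ?_)
      fun R hR c hc c' hc' hcc => ?_
    · have hR' := mem_strip.1 hR
      exact ⟨tail R, ((hmax _ hR').resolve_left (lt_irrefl _)).2, (h.isRibbon _ hR').isPath_tail⟩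
    · exact (mem_sdiff.1 hc).2 (nu.isLowerSet hcc (h.mem_and_notMem (mem_strip.1 hR) hc').1)
  · rw [show strip (insert (k, skewCells lam nu) F) k' = strip F k' by
      simp [strip, filter_insert, hk.symm]]
    exact h.isStrip k'

theorem insert (h : IsFilling n hor mu nu F) (hstep : IsRibbonStep n i nu lam)
    (hmax : ∀ p ∈ F, StepLT hor (step p) (k, i)) :
    IsFilling n hor mu lam (insert (k, skewCells lam nu) F) where
  le := h.le.trans hstep.le
  pairwiseDisjoint := by
    rw [coe_insert]
    refine h.pairwiseDisjoint.insert fun p hp _ => disjoint_left.2 fun c hc hc' => ?_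
    exact (mem_sdiff.1 hc).2 (h.mem_and_notMem hp hc').1
  biUnion_eq := by
    rw [biUnion_insert, h.biUnion_eq]
    exact sdiff_union_sdiff_cancel hstep.le h.le
  isRibbon := forall_mem_insert _ _ _ |>.2 ⟨hstep.isRibbon, h.isRibbon⟩
  label_mono := by
    intro p hp p' hp' c hc c' hc' hcc
    rcases mem_insert.1 hp with rfl | hp <;> rcases mem_insert.1 hp' with rfl | hp'
    · exact le_rfl
    · exact ((mem_sdiff.1 hc).2 (nu.isLowerSet hcc (h.mem_and_notMem hp' hc').1)).elim
    · exact (hmax p hp).label_le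
    · exact h.label_mono p hp p' hp' c hc c' hc' hcc
  isStrip := h.isStrip_insert hstep hmax

end IsFilling

theorem isFilling_empty_iff : IsFilling n hor mu lam ∅ ↔ lam = mu := by
  constructor
  · exact fun h => le_antisymm (sdiff_eq_empty_iff_subset.1 h.biUnion_eq.symm) h.le
  · rintro rfl
    constructor <;> simp [skewCells, strip, IsStrip, IsHorizontalStrip, IsVerticalStrip]

end Fillings

/-! ### Generating functions of fillings as matrix coefficients -/

section GeneratingFunction

variable {α S : Type*} [o : LinearOrder α] [CommRing S] {n : ℕ} {hor : α → Bool}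
  {mu nu lam : YoungDiagram} {F : Finset (α × Finset (ℕ × ℕ))} {p : α × Finset (ℕ × ℕ)} {k : α}
  {i : ℤ} {l : List (α × ℤ)}

open Classical in
/-- The fillings of shape `lam / mu` all of whose ribbons are added at one of the steps in `l`. -/
noncomputable def fillings (n : ℕ) (hor : α → Bool) (mu lam : YoungDiagram) (l : List (α × ℤ)) :
    Finset (Finset (α × Finset (ℕ × ℕ))) :=
  {F ∈ ((l.map Prod.fst).toFinset ×ˢ lam.cells.powerset).powerset |
    IsFilling n hor mu lam F ∧ ∀ p ∈ F, step p ∈ l}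

theorem mem_fillings :
    F ∈ fillings n hor mu lam l ↔ IsFilling n hor mu lam F ∧ ∀ p ∈ F, step p ∈ l := by
  classical
  rw [fillings, mem_filter, and_iff_right_iff_imp, mem_powerset]
  rintro ⟨hF, hFl⟩ p hp
  rw [mem_product, List.mem_toFinset, mem_powerset]
  exact ⟨List.mem_map_of_mem (hFl p hp), fun c hc => (hF.mem_and_notMem hp hc).1⟩

theorem notMem_of_mem_fillings (hl : ∀ t ∈ l, StepLT hor t (k, i))
    (hF : F ∈ fillings n hor mu lam l) (hp : step p = (k, i)) : p ∉ F := fun hpF =>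
  StepLT.irrefl (k, i) (hl _ (hp ▸ (mem_fillings.1 hF).2 p hpF))

theorem exists_erase_mem_fillings (hl : ∀ t ∈ l, StepLT hor t (k, i))
    (hF : F ∈ fillings n hor mu lam ((k, i) :: l)) (hp : p ∈ F) (hstep : step p = (k, i)) :
    ∃ nu, IsRibbonStep n i nu lam ∧ (k, skewCells lam nu) = p ∧
      F.erase p ∈ fillings n hor mu nu l := by
  obtain ⟨hF, hFl⟩ := mem_fillings.1 hF
  have hmem (p') (hp' : p' ∈ F) (hne : p' ≠ p) : step p' ∈ l :=
    (List.mem_cons.1 (hFl p' hp')).resolve_left fun heq =>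
      hne (hF.injOn_step hp' hp (heq.trans hstep.symm))
  obtain ⟨nu, hnu, hskew, hfill⟩ := hF.exists_erase hp fun p' hp' hne =>
    hstep ▸ hl _ (hmem p' hp' hne)
  obtain ⟨rfl, rfl⟩ := Prod.mk.inj hstep
  exact ⟨nu, hnu, by rw [hskew], mem_fillings.2 ⟨hfill, fun p' hp' =>
    hmem p' (mem_of_mem_erase hp') (ne_of_mem_erase hp')⟩⟩

theorem insert_mem_fillings_cons (hl : ∀ t ∈ l, StepLT hor t (k, i))
    (hnu : IsRibbonStep n i nu lam) (hF : F ∈ fillings n hor mu nu l) :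
    insert (k, skewCells lam nu) F ∈ fillings n hor mu lam ((k, i) :: l) := by
  obtain ⟨hF, hFl⟩ := mem_fillings.1 hF
  refine mem_fillings.2 ⟨hF.insert hnu fun p hp => hl _ (hFl p hp),
    forall_mem_insert _ _ _ |>.2 ⟨?_, fun p hp => List.mem_cons_of_mem _ (hFl p hp)⟩⟩
  rw [step, hnu.tail_eq]
  exact List.mem_cons_self

theorem fillings_subset_cons : fillings n hor mu lam l ⊆ fillings n hor mu lam ((k, i) :: l) :=
  fun _ hF => mem_fillings.2
    ((mem_fillings.1 hF).imp_right fun h p hp => List.mem_cons_of_mem _ (h p hp))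

theorem mem_fillings_of_mem_cons (hF : F ∈ fillings n hor mu lam ((k, i) :: l))
    (hne : ∀ p ∈ F, step p ≠ (k, i)) : F ∈ fillings n hor mu lam l := by
  obtain ⟨hF, hFl⟩ := mem_fillings.1 hF
  exact mem_fillings.2 ⟨hF, fun p hp => (List.mem_cons.1 (hFl p hp)).resolve_left (hne p hp)⟩

theorem fillings_cons (hl : ∀ t ∈ l, StepLT hor t (k, i)) (hnu : IsRibbonStep n i nu lam) :
    fillings n hor mu lam ((k, i) :: l) = fillings n hor mu lam l ∪
      (fillings n hor mu nu l).image (insert (k, skewCells lam nu)) := by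
  refine Subset.antisymm (fun F hF => mem_union.2 ?_)
    (union_subset fillings_subset_cons (image_subset_iff.2 fun F hF =>
      insert_mem_fillings_cons hl hnu hF))
  by_cases hlast : ∃ p ∈ F, step p = (k, i)
  · obtain ⟨p, hp, hstep⟩ := hlast
    obtain ⟨nu', hnu', rfl, herase⟩ := exists_erase_mem_fillings hl hF hp hstep
    obtain rfl := hnu.eq_left hnu'
    exact Or.inr (mem_image.2 ⟨_, herase, insert_erase hp⟩)
  · exact Or.inl (mem_fillings_of_mem_cons hF fun p hp hstep => hlast ⟨p, hp, hstep⟩)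

theorem fillings_cons_of_forall_not (hl : ∀ t ∈ l, StepLT hor t (k, i))
    (hnu : ∀ nu, ¬ IsRibbonStep n i nu lam) :
    fillings n hor mu lam ((k, i) :: l) = fillings n hor mu lam l := by
  refine Subset.antisymm (fun F hF => mem_fillings_of_mem_cons hF fun p hp hstep => ?_)
    fillings_subset_cons
  obtain ⟨nu, h, -⟩ := exists_erase_mem_fillings hl hF hp hstep
  exact hnu nu h

open Classical in
theorem fillings_nil : fillings n hor mu lam [] = if lam = mu then {∅} else ∅ := by
  have hempty (F) : F ∈ fillings n hor mu lam [] ↔ lam = mu ∧ F = ∅ := by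
    simp only [mem_fillings, List.not_mem_nil, imp_false, ← eq_empty_iff_forall_notMem]
    exact and_congr_left fun h => h ▸ isFilling_empty_iff
  ext F
  rw [hempty]
  split_ifs with h <;> simp [h]

/-- The weight of a filling: each ribbon contributes the weight `w` of its label and `q` to the
power of its spin. -/
def weight (q : S) (w : α → S) (F : Finset (α × Finset (ℕ × ℕ))) : S :=
  ∏ p ∈ F, w p.1 * q ^ spin p.2

theorem weight_insert (q : S) (w : α → S) (hp : p ∉ F) :
    weight q w (insert p F) = w p.1 * (q ^ spin p.2 * weight q w F) := by
  rw [weight, prod_insert hp, mul_assoc, weight]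

theorem sum_weight_fillings_cons (q : S) (w : α → S) (hl : ∀ t ∈ l, StepLT hor t (k, i))
    (hnu : IsRibbonStep n i nu lam) :
    ∑ F ∈ fillings n hor mu lam ((k, i) :: l), weight q w F =
      ∑ F ∈ fillings n hor mu lam l, weight q w F +
        w k * (q ^ spin (skewCells lam nu) * ∑ F ∈ fillings n hor mu nu l, weight q w F) := by
  have hnot {lam' F} (hF : F ∈ fillings n hor mu lam' l) : (k, skewCells lam nu) ∉ F :=
    notMem_of_mem_fillings hl hF (by rw [step, hnu.tail_eq])
  have hdisj : Disjoint (fillings n hor mu lam l)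
      ((fillings n hor mu nu l).image (insert (k, skewCells lam nu))) := by
    refine disjoint_right.2 fun F hF hF' => ?_
    obtain ⟨G, -, rfl⟩ := mem_image.1 hF
    exact hnot hF' (mem_insert_self _ _)
  have hinj : Set.InjOn (insert (k, skewCells lam nu)) 
      (fillings n hor mu nu l : Set (Finset (α × Finset (ℕ × ℕ)))) := fun F hF G hG h => by
    rw [← erase_insert (hnot hF), h, erase_insert (hnot hG)]
  rw [fillings_cons hl hnu, sum_union hdisj, sum_image hinj, mul_sum, mul_sum]
  exact congrArg _ (sum_congr rfl fun F hF => weight_insert q w (hnot hF))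

open Classical in
/-- The basis vector of the bead configuration of `mu`. -/
noncomputable def beadsVector (S : Type*) [CommRing S] (mu : YoungDiagram) : Set ℤ → S :=
  Pi.single (beads mu) 1

theorem prod_steps_apply_beads (q : S) (w : α → S) (hl : l.Pairwise fun t t' => StepLT hor t' t)
    (lam : YoungDiagram) :
    (l.map fun t => 1 + w t.1 • addRibbon n q t.2).prod (beadsVector S mu) (beads lam) =
      ∑ F ∈ fillings n hor mu lam l, weight q w F := by
  induction l generalizing lam with
  | nil =>
    rw [fillings_nil, List.map_nil, List.prod_nil, Module.End.one_apply, beadsVector,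
      Pi.single_apply]
    rcases eq_or_ne lam mu with rfl | hne
    · simp [weight]
    · simp [hne, beads_injective.ne hne]
  | cons t l ih =>
    obtain ⟨k, i⟩ := t
    rw [List.pairwise_cons] at hl
    simp only [List.map_cons, List.prod_cons, Module.End.mul_apply, LinearMap.add_apply,
      Module.End.one_apply, LinearMap.smul_apply, Pi.add_apply, Pi.smul_apply, smul_eq_mul,
      addRibbon_apply, ih hl.2]
    split_ifs with hmove
    · obtain ⟨nu, hnu⟩ := exists_isRibbonStep hmove
      rw [hnu.moveDown_beads, ih hl.2, sum_weight_fillings_cons q w hl.1 hnu, hnu.spin_eq]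
    · rw [fillings_cons_of_forall_not hl.1 fun nu h => hmove h.canMoveDown_beads, mul_zero,
        add_zero]

/-- The contents of the boxes of `lam` in decreasing order. -/
def contents (lam : YoungDiagram) : List ℤ := (lam.cells.image content).sort (· ≥ ·)

/-- All the steps at which a ribbon of a filling of shape `lam / mu` can be added, the last step
first. -/
def allSteps [Fintype α] (hor : α → Bool) (lam : YoungDiagram) : List (α × ℤ) :=
  ((univ : Finset α).sort (· ≥ ·)).flatMap fun k =>
    (if hor k then contents lam else (contents lam).reverse).map (Prod.mk k)

variable [Fintype α]

theorem pairwise_allSteps (hor : α → Bool) (lam : YoungDiagram) :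
    (allSteps hor lam).Pairwise fun t t' => StepLT hor t' t := by
  have hcontents : (contents lam).Pairwise (· > ·) := (sortedGT_sort _).pairwise
  refine List.pairwise_flatMap.2 ⟨fun k _ => ?_,
    (sortedGT_sort _).pairwise.imp fun h t ht t' ht' => ?_⟩
  · rw [List.pairwise_map]
    split_ifs with hk
    · exact hcontents.imp fun h => Or.inr ⟨rfl, by simpa [StripLT, hk] using h⟩
    · rw [List.pairwise_reverse]
      exact hcontents.imp fun h => Or.inr ⟨rfl, by simpa [StripLT, hk] using h⟩
  · obtain ⟨_, -, rfl⟩ := List.mem_map.1 ht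
    obtain ⟨_, -, rfl⟩ := List.mem_map.1 ht'
    exact Or.inl h

theorem mem_fillings_allSteps :
    F ∈ fillings n hor mu lam (allSteps hor lam) ↔ IsFilling n hor mu lam F := by
  rw [mem_fillings, and_iff_left_iff_imp]
  intro hF p hp
  obtain ⟨c, hc, htail⟩ := exists_content_eq_tail (hF.isRibbon p hp).nonempty
  have hmem : tail p.2 ∈ contents lam :=
    (mem_sort _).2 (mem_image.2 ⟨c, (hF.mem_and_notMem hp hc).1, htail⟩)
  refine List.mem_flatMap.2 ⟨p.1, by simp, List.mem_map.2 ⟨tail p.2, ?_, rfl⟩⟩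
  split_ifs
  · exact hmem
  · exact List.mem_reverse.2 hmem

theorem sum_weight_fillings_allSteps (q : S) (w : α → S) :
    ∑ F ∈ fillings n hor mu lam (allSteps hor lam), weight q w F =
      (((univ : Finset α).sort (· ≥ ·)).map fun k =>
        stripProd (addRibbon n q) (contents lam) (hor k) (w k)).prod
          (beadsVector S mu) (beads lam) := by
  rw [← prod_steps_apply_beads q w (pairwise_allSteps hor lam), allSteps, List.map_flatMap,
    List.flatMap_def, List.prod_flatten]
  simp only [stripProd, orderedProd, List.map_map, Function.comp_def]

theorem sum_weight_fillings_comp_equiv {β : Type*} [o' : LinearOrder β] [Fintype β] {q : S}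
    (hq : IsLeftRegular q) (e : α ≃ β) (hor : β → Bool) (w : β → S) :
    ∑ F ∈ fillings n (hor ∘ e) mu lam (allSteps (hor ∘ e) lam), weight q (w ∘ e) F =
      ∑ F ∈ fillings n hor mu lam (allSteps hor lam), weight q w F := by
  let U (k : β) := stripProd (addRibbon n q) (contents lam) (hor k) (w k)
  have hperm : (((univ : Finset α).sort (· ≥ ·)).map e).Perm ((univ : Finset β).sort (· ≥ ·)) := by
    rw [List.perm_ext_iff_of_nodup ((sort_nodup _ _).map e.injective) (sort_nodup _ _)]
    simpa using fun k => ⟨e.symm k, e.apply_symm_apply k⟩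
  have hcomm (k k' : β) : Commute (U k) (U k') :=
    (ribbonRelations_addRibbon n hq).stripProd_commute (sortedGT_sort _) _ _ _ _
  rw [sum_weight_fillings_allSteps, sum_weight_fillings_allSteps,
    ← (hperm.map U).prod_eq' (List.pairwise_of_forall_mem_list ?_), List.map_map]
  · rfl
  · simp only [List.mem_map]
    rintro _ ⟨k, -, rfl⟩ _ ⟨k', -, rfl⟩
    exact hcomm _ _

end GeneratingFunction

/-! ### Super ribbon tableaux -/

section Tableaux

namespace IsFilling

variable {α : Type*} [LinearOrder α] {n : ℕ} {hor : α → Bool} {mu lam : YoungDiagram}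
  {F : Finset (α × Finset (ℕ × ℕ))}

theorem injOn_snd (h : IsFilling n hor mu lam F) :
    Set.InjOn Prod.snd (F : Set (α × Finset (ℕ × ℕ))) := by
  intro p hp p' hp' hsnd
  obtain ⟨c, hc⟩ := (h.isRibbon p hp).nonempty
  exact h.eq_of_mem hp hp' hc (hsnd ▸ hc)

theorem exists_initial (h : IsFilling n hor mu lam F) (k : α) :
    ∃ nu : YoungDiagram, mu ≤ nu ∧
      ∀ c, c ∈ skewCells nu mu ↔ ∃ p ∈ F, p.1 ≤ k ∧ c ∈ p.2 := by
  let cells := mu.cells ∪ (F.filter fun p => p.1 ≤ k).biUnion Prod.snd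
  have hmem (c : ℕ × ℕ) : c ∈ cells ↔ c ∈ mu ∨ ∃ p ∈ F, p.1 ≤ k ∧ c ∈ p.2 := by
    simp only [cells, mem_union, YoungDiagram.mem_cells, mem_biUnion, mem_filter, and_assoc]
  have hlower : IsLowerSet (cells : Set (ℕ × ℕ)) := by
    intro c d hdc hc
    rw [mem_coe, hmem] at hc ⊢
    by_cases hd : d ∈ mu
    · exact Or.inl hd
    obtain hc | ⟨p, hp, hpk, hcp⟩ := hc
    · exact absurd (mu.isLowerSet hdc hc) hd
    have hdlam : d ∈ lam := lam.isLowerSet hdc (h.mem_and_notMem hp hcp).1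
    obtain ⟨p', hp', hdp'⟩ := h.mem_skewCells_iff.1 (mem_sdiff.2 ⟨hdlam, hd⟩)
    exact Or.inr ⟨p', hp', (h.label_mono p' hp' p hp d hdp' c hcp hdc).trans hpk, hdp'⟩
  refine ⟨⟨cells, hlower⟩, subset_union_left, fun c => ?_⟩
  rw [skewCells, mem_sdiff, hmem, YoungDiagram.mem_cells]
  constructor
  · rintro ⟨hc | hc, hmu⟩
    exacts [absurd hc hmu, hc]
  · rintro ⟨p, hp, hpk, hcp⟩
    exact ⟨Or.inr ⟨p, hp, hpk, hcp⟩, (h.mem_and_notMem hp hcp).2⟩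

/-- The tiling by the ribbons of a filling. -/
def finpartition (h : IsFilling n hor mu lam F) : Finpartition (skewCells lam mu) where
  parts := F.image Prod.snd
  supIndep := by
    rw [supIndep_iff_pairwiseDisjoint, coe_image]
    exact h.injOn_snd.pairwiseDisjoint_image.2 h.pairwiseDisjoint
  sup_parts := by
    rw [sup_image, Function.id_comp, sup_eq_biUnion, h.biUnion_eq]
  bot_notMem hbot := by
    obtain ⟨p, hp, hempty⟩ := mem_image.1 hbot
    exact (h.isRibbon p hp).nonempty.ne_empty hempty

theorem exists_label (h : IsFilling n hor mu lam F) :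
    ∃ f : {R // R ∈ h.finpartition.parts} → α,
      ∀ p, p ∈ F ↔ ∃ hR : p.2 ∈ h.finpartition.parts, f ⟨p.2, hR⟩ = p.1 := by
  have hex (R : {R // R ∈ h.finpartition.parts}) : ∃ k, (k, R.1) ∈ F := by
    obtain ⟨p, hp, hpR⟩ := mem_image.1 R.2
    exact ⟨p.1, hpR ▸ hp⟩
  choose f hf using hex
  refine ⟨f, fun p => ⟨fun hp => ?_, ?_⟩⟩
  · have hR : p.2 ∈ h.finpartition.parts := mem_image_of_mem Prod.snd hp
    exact ⟨hR, congrArg Prod.fst (h.injOn_snd (hf ⟨p.2, hR⟩) hp rfl)⟩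
  · rintro ⟨hR, hk⟩
    simpa only [hk] using hf ⟨p.2, hR⟩

end IsFilling

variable {n r s : ℕ} {mu lam : YoungDiagram}

namespace SuperRibbonTableau

variable [o : LinearOrder (Fin r ⊕ Fin s)]

/-- The set of labelled ribbons of a tableau. -/
def toFilling (T : SuperRibbonTableau n lam mu o) :
    Finset ((Fin r ⊕ Fin s) × Finset (ℕ × ℕ)) :=
  univ.image fun R : {R // R ∈ T.tiling.parts} => (T.label R, R.1)

theorem mem_toFilling {T : SuperRibbonTableau n lam mu o}
    {p : (Fin r ⊕ Fin s) × Finset (ℕ × ℕ)} :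
    p ∈ T.toFilling ↔ ∃ h : p.2 ∈ T.tiling.parts, T.label ⟨p.2, h⟩ = p.1 := by
  simp only [toFilling, mem_image, mem_univ, true_and, Prod.ext_iff, Subtype.exists]
  constructor
  · rintro ⟨R, h, hlabel, rfl⟩
    exact ⟨h, hlabel⟩
  · rintro ⟨h, hlabel⟩
    exact ⟨p.2, h, hlabel, rfl⟩

theorem mk_label_mem_toFilling (T : SuperRibbonTableau n lam mu o)
    (R : {R // R ∈ T.tiling.parts}) : (T.label R, R.1) ∈ T.toFilling :=
  mem_toFilling.2 ⟨R.2, rfl⟩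

theorem strip_toFilling (T : SuperRibbonTableau n lam mu o) (k : Fin r ⊕ Fin s) :
    strip T.toFilling k = (univ.filter fun R => T.label R = k).image Subtype.val := by
  ext R
  simp [mem_toFilling]

theorem injOn_snd_toFilling (T : SuperRibbonTableau n lam mu o) :
    Set.InjOn Prod.snd (T.toFilling : Set ((Fin r ⊕ Fin s) × Finset (ℕ × ℕ))) := by
  intro p hp p' hp' hsnd
  obtain ⟨h, hlabel⟩ := mem_toFilling.1 hp
  obtain ⟨h', hlabel'⟩ := mem_toFilling.1 hp'
  refine Prod.ext ?_ hsnd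
  rw [← hlabel, ← hlabel']
  exact congrArg T.label (Subtype.ext hsnd)

theorem image_snd_toFilling (T : SuperRibbonTableau n lam mu o) :
    T.toFilling.image Prod.snd = T.tiling.parts := by
  rw [toFilling, image_image]
  exact (univ_eq_attach _).symm ▸ attach_image_val

theorem pairwiseDisjoint_toFilling (T : SuperRibbonTableau n lam mu o) :
    (T.toFilling : Set ((Fin r ⊕ Fin s) × Finset (ℕ × ℕ))).PairwiseDisjoint Prod.snd := by
  refine T.injOn_snd_toFilling.pairwiseDisjoint_image (f := id).1 ?_
  rw [← coe_image, image_snd_toFilling]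
  exact T.tiling.disjoint

/-- Stated with `o.le` because `≤` would be the disjoint-union order of `Sum`. -/
theorem label_mono_toFilling (T : SuperRibbonTableau n lam mu o)
    {p p' : (Fin r ⊕ Fin s) × Finset (ℕ × ℕ)} (hp : p ∈ T.toFilling) (hp' : p' ∈ T.toFilling)
    {c c' : ℕ × ℕ} (hc : c ∈ p.2) (hc' : c' ∈ p'.2) (hle : c ≤ c') :
    o.le p.1 p'.1 := by
  obtain ⟨h, -⟩ := mem_toFilling.1 hp
  obtain ⟨h', hlabel'⟩ := mem_toFilling.1 hp'
  obtain ⟨nu, -, hnu⟩ := T.initial p'.1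
  have hc'nu : c' ∈ nu := (mem_sdiff.1 ((hnu c').2 ⟨⟨p'.2, h'⟩, hlabel' ▸ o.le_refl _, hc'⟩)).1
  have hcmu : c ∉ mu := (mem_sdiff.1 (T.tiling.le h hc)).2
  obtain ⟨R, hR, hcR⟩ := (hnu c).1 (mem_sdiff.2 ⟨nu.isLowerSet hle hc'nu, hcmu⟩)
  rw [T.pairwiseDisjoint_toFilling.elim_finset hp (T.mk_label_mem_toFilling R) c hc hcR]
  exact hR

theorem isFilling_toFilling (hmu : mu ≤ lam) (T : SuperRibbonTableau n lam mu o) :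
    IsFilling n Sum.isLeft mu lam T.toFilling where
  le := hmu
  pairwiseDisjoint := T.pairwiseDisjoint_toFilling
  biUnion_eq := by
    rw [← T.tiling.sup_parts, ← image_snd_toFilling, sup_image, Function.id_comp, sup_eq_biUnion]
  isRibbon p hp := T.ribbon _ (mem_toFilling.1 hp).1
  label_mono _ hp _ hp' _ hc _ hc' := T.label_mono_toFilling hp hp' hc hc'
  isStrip := by
    rintro (a | b) <;> rw [strip_toFilling]
    exacts [T.horizontal a, T.vertical b]

theorem toFilling_injective :
    Function.Injective (toFilling : SuperRibbonTableau n lam mu o → _) := by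
  intro T T' h
  have htiling : T.tiling = T'.tiling :=
    Finpartition.ext (by rw [← image_snd_toFilling, h, image_snd_toFilling])
  obtain ⟨P, f, _, _, _, _⟩ := T
  obtain ⟨P', f', _, _, _, _⟩ := T'
  obtain rfl : P = P' := htiling
  congr 1
  funext R
  obtain ⟨_, hlabel⟩ := mem_toFilling.1 (h ▸ mk_label_mem_toFilling _ R)
  exact hlabel.symm

theorem exists_toFilling_eq {F : Finset ((Fin r ⊕ Fin s) × Finset (ℕ × ℕ))}
    (hF : IsFilling n Sum.isLeft mu lam F) :
    ∃ T : SuperRibbonTableau n lam mu o, T.toFilling = F := by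
  obtain ⟨f, hf⟩ := hF.exists_label
  have hstrip (k) : strip F k = (univ.filter fun R => f R = k).image Subtype.val := by
    ext R
    simp [hf]
  refine ⟨⟨hF.finpartition, f, fun R hR => hF.isRibbon _ ((hf (f ⟨R, hR⟩, R)).2 ⟨hR, rfl⟩),
    fun a => hstrip (Sum.inl a) ▸ hF.isStrip (Sum.inl a),
    fun b => hstrip (Sum.inr b) ▸ hF.isStrip (Sum.inr b), fun k => ?_⟩, ?_⟩
  · obtain ⟨nu, hnu, hc⟩ := hF.exists_initial k
    refine ⟨nu, hnu, fun c => (hc c).trans ⟨?_, ?_⟩⟩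
    · rintro ⟨p, hp, hpk, hcp⟩
      obtain ⟨hR, hlabel⟩ := (hf p).1 hp
      exact ⟨⟨p.2, hR⟩, hlabel ▸ hpk, hcp⟩
    · rintro ⟨R, hRk, hcR⟩
      exact ⟨(f R, R.1), (hf _).2 ⟨R.2, rfl⟩, hRk, hcR⟩
  · ext p
    rw [mem_toFilling, hf]

variable {S : Type*} [CommRing S]

theorem weight_toFilling (q : S) (w : Fin r ⊕ Fin s → S) (T : SuperRibbonTableau n lam mu o) :
    weight q w T.toFilling = q ^ T.spin * ∏ k, w k ^ T.wt k := by
  have hlabels : ∏ R, w (T.label R) = ∏ k, w k ^ T.wt k := by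
    rw [← prod_fiberwise' univ T.label w]
    exact prod_congr rfl fun k _ => prod_const _
  have hspins : ∏ R : {R // R ∈ T.tiling.parts}, q ^ SuperLLT.spin R.1 = q ^ T.spin := by
    rw [prod_pow_eq_pow_sum, sum_coe_sort T.tiling.parts SuperLLT.spin, spin]
  rw [weight, toFilling, prod_image fun R _ R' _ h => Subtype.ext (congrArg Prod.snd h),
    prod_mul_distrib, hlabels, hspins, mul_comm]

theorem sum_eq_sum_fillings (hmu : mu ≤ lam) (q : S) (w : Fin r ⊕ Fin s → S) :
    ∑ T : SuperRibbonTableau n lam mu o, q ^ T.spin * ∏ k, w k ^ T.wt k =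
      ∑ F ∈ fillings n Sum.isLeft mu lam (allSteps Sum.isLeft lam), weight q w F := by
  refine sum_bij (fun T _ => T.toFilling)
    (fun T _ => mem_fillings_allSteps.2 (T.isFilling_toFilling hmu))
    (fun T _ T' _ h => toFilling_injective h) (fun F hF => ?_)
    (fun T _ => (T.weight_toFilling q w).symm)
  obtain ⟨T, hT⟩ := exists_toFilling_eq (mem_fillings_allSteps.1 hF)
  exact ⟨T, mem_univ T, hT⟩

end SuperRibbonTableau

/-- The weight `x_a` or `-y_b` that a label contributes to the super LLT polynomial. -/
noncomputable def labelWeight : Fin r ⊕ Fin s → MvPolynomial (Fin r ⊕ Fin s) (Polynomial ℤ) :=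
  Sum.elim (fun a => MvPolynomial.X (Sum.inl a)) fun b => -MvPolynomial.X (Sum.inr b)

theorem superLLT_eq_sum_prod (n : ℕ) (lam mu : YoungDiagram) (o : LinearOrder (Fin r ⊕ Fin s)) :
    superLLT n lam mu o = ∑ T : SuperRibbonTableau n lam mu o,
      MvPolynomial.C Polynomial.X ^ T.spin * ∏ k, labelWeight k ^ T.wt k := by
  simp only [superLLT, Fintype.prod_sum_type, labelWeight, Sum.elim_inl, Sum.elim_inr, map_pow,
    mul_assoc]

theorem rename_superLLT (n : ℕ) (lam mu : YoungDiagram) (o : LinearOrder (Fin r ⊕ Fin s))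
    (σ : Equiv.Perm (Fin r)) (τ : Equiv.Perm (Fin s)) :
    MvPolynomial.rename (Sum.map σ τ) (superLLT n lam mu o) =
      ∑ T : SuperRibbonTableau n lam mu o, MvPolynomial.C Polynomial.X ^ T.spin *
        ∏ k, (labelWeight ∘ Equiv.sumCongr σ τ) k ^ T.wt k := by
  have hrename (k : Fin r ⊕ Fin s) : MvPolynomial.rename (Sum.map σ τ) (labelWeight k) =
      (labelWeight ∘ Equiv.sumCongr σ τ) k := by
    obtain a | b := k <;> simp [labelWeight]
  simp only [superLLT_eq_sum_prod, map_sum, map_mul, map_pow, map_prod, MvPolynomial.rename_C,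
    hrename]

end Tableaux

end SuperLLT

theorem mainTheorem7_general (n : ℕ) (lam mu : YoungDiagram) (hmu : mu ≤ lam) (r s : ℕ)
    (o o' : LinearOrder (Fin r ⊕ Fin s)) (σ : Equiv.Perm (Fin r)) (τ : Equiv.Perm (Fin s)) :
    MvPolynomial.rename (Sum.map σ τ) (SuperLLT.superLLT n lam mu o) =
      SuperLLT.superLLT n lam mu o' := by
  have hq : IsLeftRegular
      (MvPolynomial.C Polynomial.X : MvPolynomial (Fin r ⊕ Fin s) (Polynomial ℤ)) :=
    IsLeftCancelMulZero.mul_left_cancel_of_ne_zero (by simp)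
  have hkind : Sum.isLeft ∘ Equiv.sumCongr σ τ = Sum.isLeft := by
    ext (a | b) <;> rfl
  rw [SuperLLT.rename_superLLT, SuperLLT.superLLT_eq_sum_prod,
    SuperLLT.SuperRibbonTableau.sum_eq_sum_fillings (o := o) hmu,
    SuperLLT.SuperRibbonTableau.sum_eq_sum_fillings (o := o') hmu]
  simpa only [hkind] using SuperLLT.sum_weight_fillings_comp_equiv (o := o) (o' := o') hq
    (Equiv.sumCongr σ τ) Sum.isLeft SuperLLT.labelWeight

theorem mainTheorem7 (n : ℕ) (hn : 1 ≤ n) (lam mu : YoungDiagram) (hmu : mu ≤ lam) (r s : ℕ) :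
    (∀ o : LinearOrder (Fin r ⊕ Fin s), SuperLLT.RespectsAlphabets o →
      (∀ σ : Equiv.Perm (Fin r),
        MvPolynomial.rename (Sum.map σ id) (SuperLLT.superLLT n lam mu o) =
          SuperLLT.superLLT n lam mu o) ∧
      (∀ τ : Equiv.Perm (Fin s),
        MvPolynomial.rename (Sum.map id τ) (SuperLLT.superLLT n lam mu o) =
          SuperLLT.superLLT n lam mu o)) ∧
    (∀ o o' : LinearOrder (Fin r ⊕ Fin s),
      SuperLLT.RespectsAlphabets o → SuperLLT.RespectsAlphabets o' →
        SuperLLT.superLLT n lam mu o = SuperLLT.superLLT n lam mu o') :=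
  ⟨fun o _ => ⟨fun σ => mainTheorem7_general n lam mu hmu r s o o σ 1,
    fun τ => mainTheorem7_general n lam mu hmu r s o o 1 τ⟩,
    fun o o' _ _ => by simpa using mainTheorem7_general n lam mu hmu r s o o' 1 1⟩
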